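/- All systems are finite-dimensional and nonzero. Fix $\varepsilon\in[0,1]$ and let $\mathcal N_{A\to B}$ be a quantum channel. For states $\rho,\sigma$ let $D^{\varepsilon}_{\min}(\rho\Vert\sigma) := -\log_2 \inf_{0\le\Lambda\le I}\{\operatorname{Tr}[\Lambda\sigma] : \operatorname{Tr}[\Lambda\rho]\ge 1-\varepsilon\}$ (with $-\log_2 0=+\infty$), and for channels let $D^{\varepsilon}_{\min}(\mathcal N\Vert\mathcal M) := \sup_{\rho_{RA}} D^{\varepsilon}_{\min}(\mathcal N_{A\to B}(\rho_{RA})\Vert\mathcal M_{A\to B}(\rho_{RA}))$, the supremum being over all states $\rho_{RA}$ with an arbitrary finite-dimensional reference system $R$. Let $\mathcal F(\mathcal N) := \{\operatorname{Tr}_B\circ\mathcal P_{A\to BE} : \mathcal P \text{ a channel},\ \operatorname{Tr}_E\circ\mathcal P_{A\to BE}=\mathcal N_{A\to B}\}$ with $E\cong B$, and set $$E^{u,\varepsilon}_{\min}(\mathcal N) := \tfrac12\inf_{\mathcal M\in\mathcal F(\mathcal N)} D^{\varepsilon}_{\min}(\mathcal N\Vert\mathcal M),\qquad J^{\varepsilon}_{\min}(\mathcal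 N) := 2^{-2E^{u,\varepsilon}_{\min}(\mathcal N)} .$$ Let $V:A\to BE$ be an isometric extension of $\mathcal N$ (that is, $V^\dagger V=I$ and $\operatorname{Tr}_E[V\cdot V^\dagger]=\mathcal N$). A one-way LOCC superchannel $\Theta$ with classical input $X$ and classical output $\hat X$, both with alphabet $\mathcal X$, $1\le|\mathcal X|<\infty$, consists of a quantum instrument $\{\mathcal E^m_{X\to A}\}_m$ of Alice and channels $\{\mathcal D^m_{B\to\hat X}\}_m$ of Bob, with finitely many classical labels $m$. The labels are sent publicly, so that the eavesdropper holds the environment $E$ and a copy $M$ of the label; on the message $x$ the joint state of Bob and the eavesdropper is $$\omega^x_{\hat XEM} := \sum_m (\mathcal D^m_{B\to\hat X}\otimes\operatorname{id}_E)\big(V\,\mathcal E^m(|x\rangle\!\langle x|)\,V^\dagger\big)\otimes|m\rangle\!\langle m|_M .$$ With the fidelity $F(\rho,\sigma):=(\operatorname{Tr}\sqrt{\sqrt\sigma\rho\sqrt\sigma})^2$, let $p_{\rm err}(\Theta,\mathcal N) := \inf_{\sigma_{EM}}\max_{x\in\mathcal X}\big(1-F(|x\rangle\!\langle x|_{\hat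 X}\otimes\sigma_{EM},\,\omega^x_{\hat XEM})\big)$, the infimum being over all states $\sigma_{EM}$. The one-shot forward-assisted private capacity $P^{\varepsilon,\to}(\mathcal N)$ is the supremum of $\log_2|\mathcal X|$ over all such $\mathcal X$ and $\Theta$ with $p_{\rm err}(\Theta,\mathcal N)\le\varepsilon$. If $J^{\varepsilon}_{\min}(\mathcal N)>\varepsilon$, then (for every choice of the isometric extension $V$) $$P^{\varepsilon,\to}(\mathcal N)\le-\log_2\!\Big(\sqrt{J^{\varepsilon}_{\min}(\mathcal N)}-\sqrt\varepsilon\Big).$$ If moreover $J^{\varepsilon}_{\min}(\mathcal N)>\sqrt\varepsilon$, then also $$P^{\varepsilon,\to}(\mathcal N)\le-\tfrac12\log_2\!\big(J^{\varepsilon}_{\min}(\mathcal N)-\sqrt\varepsilon\big).$$ -/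

import Mathlib

open scoped ComplexOrder MatrixOrder

noncomputable section

namespace QKey

/-! Finite-dimensional quantum systems are index types `a, b, …` (Hilbert spaces `ℂ^a, ℂ^b, …`),
operators are complex matrices, and a composite system is a product of index types. -/

section Basic

variable {a b r : Type*}

/-- Quantum states: positive semidefinite operators of unit trace. -/
def IsState [Fintype a] (ρ : Matrix a a ℂ) : Prop :=
  ρ.PosSemidef ∧ ρ.trace = 1

/-- The map `id_R ⊗ Φ` on operators of the composite system `RA`. -/
def idTensor (r : Type*) (Φ : Matrix a a ℂ →ₗ[ℂ] Matrix b b ℂ) :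
    Matrix (r × a) (r × a) ℂ →ₗ[ℂ] Matrix (r × b) (r × b) ℂ where
  toFun X := Matrix.of fun p q => Φ (Matrix.of fun i j => X (p.1, i) (q.1, j)) p.2 q.2
  map_add' X Y := by
    ext p q
    exact congrFun (congrFun (Φ.map_add (Matrix.of fun i j => X (p.1, i) (q.1, j))
      (Matrix.of fun i j => Y (p.1, i) (q.1, j))) p.2) q.2
  map_smul' c X := by
    ext p q
    exact congrFun (congrFun (Φ.map_smul c (Matrix.of fun i j => X (p.1, i) (q.1, j))) p.2) q.2

/-- Complete positivity. -/
def IsCP (Φ : Matrix a a ℂ →ₗ[ℂ] Matrix b b ℂ) : Prop :=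
  ∀ (n : ℕ) (X : Matrix (Fin n × a) (Fin n × a) ℂ),
    X.PosSemidef → (idTensor (Fin n) Φ X).PosSemidef

/-- Trace preservation. -/
def IsTP [Fintype a] [Fintype b] (Φ : Matrix a a ℂ →ₗ[ℂ] Matrix b b ℂ) : Prop :=
  ∀ X : Matrix a a ℂ, (Φ X).trace = X.trace

/-- Quantum channels: completely positive and trace-preserving linear maps. -/
def IsChannel [Fintype a] [Fintype b] (Φ : Matrix a a ℂ →ₗ[ℂ] Matrix b b ℂ) : Prop :=
  IsCP Φ ∧ IsTP Φ

/-- Partial trace over the second factor of a composite system. -/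
def traceSnd [Fintype b] (X : Matrix (a × b) (a × b) ℂ) : Matrix a a ℂ :=
  Matrix.of fun i j => ∑ k, X (i, k) (j, k)

/-- Partial trace over the first factor of a composite system. -/
def traceFst [Fintype a] (X : Matrix (a × b) (a × b) ℂ) : Matrix b b ℂ :=
  Matrix.of fun i j => ∑ k, X (k, i) (k, j)

/-- The fidelity `F(ρ, σ) = (Tr √(√σ ρ √σ))²`. -/
def fidelity [Fintype a] [DecidableEq a] (ρ σ : Matrix a a ℂ) : ℝ :=
  ((CFC.sqrt (CFC.sqrt σ * ρ * CFC.sqrt σ)).trace.re) ^ 2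

end Basic

section Unextendible

variable {a b : Type*}

/-- The least type-II error `inf {Tr[Λσ] : 0 ≤ Λ ≤ I, Tr[Λρ] ≥ 1 - ε}`. -/
def hypTestError [Fintype a] [DecidableEq a] (ε : ℝ) (ρ σ : Matrix a a ℂ) : ℝ :=
  sInf {t : ℝ | ∃ Λ : Matrix a a ℂ, Λ.PosSemidef ∧ (1 - Λ).PosSemidef ∧
    1 - ε ≤ (Λ * ρ).trace.re ∧ t = (Λ * σ).trace.re}

/-- The function `t ↦ -log₂ t` on `[0, ∞)`, with value `+∞` at `0`. -/
def negLogTwo (t : ℝ) : EReal :=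
  if t ≤ 0 then ⊤ else ((-Real.logb 2 t : ℝ) : EReal)

/-- Smooth min-relative entropy `D^ε_min(ρ‖σ)` of states. -/
def smoothMinRelEnt [Fintype a] [DecidableEq a] (ε : ℝ) (ρ σ : Matrix a a ℂ) : EReal :=
  negLogTwo (hypTestError ε ρ σ)

/-- Smooth min-relative entropy `D^ε_min(N‖M)` of channels: the supremum over all states `ρ_{RA}`
with a finite-dimensional reference system `R`. -/
def smoothMinRelEntChannel [Fintype a] [Fintype b] [DecidableEq b] (ε : ℝ)
    (N M : Matrix a a ℂ →ₗ[ℂ] Matrix b b ℂ) : EReal :=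
  ⨆ (n : ℕ) (ρ : Matrix (Fin n × a) (Fin n × a) ℂ) (_ : IsState ρ),
    smoothMinRelEnt ε (idTensor (Fin n) N ρ) (idTensor (Fin n) M ρ)

/-- The set `F(N)` of the channels `Tr_B ∘ P_{A→BE}`, where `E` is a copy of `B` and `P` is a
channel with `Tr_E ∘ P_{A→BE} = N`. -/
def freeChannels [Fintype a] [Fintype b] (N : Matrix a a ℂ →ₗ[ℂ] Matrix b b ℂ) :
    Set (Matrix a a ℂ →ₗ[ℂ] Matrix b b ℂ) :=
  {M | ∃ P : Matrix a a ℂ →ₗ[ℂ] Matrix (b × b) (b × b) ℂ, IsChannel P ∧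
    (∀ X, traceSnd (P X) = N X) ∧ (∀ X, traceFst (P X) = M X)}

/-- Smooth-min unextendible entanglement `E^{u,ε}_min(N)` of a channel. -/
def smoothMinUnextEnt [Fintype a] [Fintype b] [DecidableEq b] (ε : ℝ)
    (N : Matrix a a ℂ →ₗ[ℂ] Matrix b b ℂ) : EReal :=
  ((1 / 2 : ℝ) : EReal) * ⨅ M ∈ freeChannels N, smoothMinRelEntChannel ε N M

/-- `J^ε_min(N) = 2^(-2 E^{u,ε}_min(N))`, with `2^(-∞) = 0`. -/
def Jmin [Fintype a] [Fintype b] [DecidableEq b] (ε : ℝ)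
    (N : Matrix a a ℂ →ₗ[ℂ] Matrix b b ℂ) : ℝ :=
  if smoothMinUnextEnt ε N = ⊤ then 0
  else (2 : ℝ) ^ (-2 * (smoothMinUnextEnt ε N).toReal)

end Unextendible

section PrivateCommunication

/-- A one-way LOCC superchannel `(A→B) → (C→D)`: Alice applies a quantum instrument
`{E^m_{C→A}}_m`, sends the classical label `m` to Bob, and Bob applies the channel `D^m_{B→D}` to
the output of the channel. It maps `N` to `∑_m D^m ∘ N ∘ E^m`. -/
structure OneWayLOCC (a b c d : Type*) [Fintype a] [Fintype b] [Fintype c] [Fintype d] where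
  /-- The number of classical labels. -/
  labels : ℕ
  /-- Alice's instrument. -/
  pre : Fin labels → (Matrix c c ℂ →ₗ[ℂ] Matrix a a ℂ)
  /-- Bob's channels. -/
  post : Fin labels → (Matrix b b ℂ →ₗ[ℂ] Matrix d d ℂ)
  pre_cp : ∀ m, IsCP (pre m)
  pre_tp : IsTP (∑ m, pre m)
  post_channel : ∀ m, IsChannel (post m)

variable {a b c d e : Type*} [Fintype a] [Fintype b] [Fintype c] [Fintype d]

/-- `V : ℂ^a → ℂ^b ⊗ ℂ^e` is an isometric extension of `N`. -/
def IsIsometricExtension [DecidableEq a] [Fintype e]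
    (N : Matrix a a ℂ →ₗ[ℂ] Matrix b b ℂ) (V : Matrix (b × e) a ℂ) : Prop :=
  V.conjTranspose * V = 1 ∧ ∀ X, traceSnd (V * X * V.conjTranspose) = N X

/-- The joint operator of Bob and the eavesdropper when the superchannel `Θ` acts on the isometric
extension `X ↦ V X V†` (on its `A→B` part) and the result is applied to the input `X`. The
eavesdropper holds the environment `E` and, since the classical communication is public, a copy of
the label `m`: the operator is
`∑_m (D^m_{B→D} ⊗ id_E)(V E^m(X) V†) ⊗ |m⟩⟨m|`, on the system `D ⊗ (E ⊗ M)`. -/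
def bobEveState (Θ : OneWayLOCC a b c d) (V : Matrix (b × e) a ℂ) (X : Matrix c c ℂ) :
    Matrix (d × (e × Fin Θ.labels)) (d × (e × Fin Θ.labels)) ℂ :=
  Matrix.of fun p q =>
    if p.2.2 = q.2.2 then
      Θ.post p.2.2
        (Matrix.of fun i j => (V * Θ.pre p.2.2 X * V.conjTranspose) (i, p.2.1) (j, q.2.1)) p.1 q.1
    else 0

/-- The error of private communication of `k` messages,
`inf_σ max_x (1 - F(|x⟩⟨x| ⊗ σ, Θ(V)(|x⟩⟨x|)))`, where `σ` ranges over the states of the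
eavesdropper's systems. -/
def privateError [Fintype e] [DecidableEq e] {k : ℕ} (Θ : OneWayLOCC a b (Fin k) (Fin k))
    (V : Matrix (b × e) a ℂ) : ℝ :=
  ⨅ σ : {σ : Matrix (e × Fin Θ.labels) (e × Fin Θ.labels) ℂ // IsState σ}, ⨆ x : Fin k,
    (1 - fidelity (Matrix.kronecker (Matrix.single x x (1 : ℂ)) σ.1)
      (bobEveState Θ V (Matrix.single x x (1 : ℂ))))

/-- The one-shot forward-assisted private capacity `P^{ε,→}` of the channel with the isometric
extension `V`: the supremum of `log₂ k` over the message sets of size `k ≥ 1` and the one-way LOCC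
superchannels with classical input (only the inputs `|x⟩⟨x|` are used) and classical output (Bob's
outputs are diagonal) whose error of private communication is at most `ε`. -/
def forwardPrivateCapacity [Fintype e] [DecidableEq e] (ε : ℝ) (V : Matrix (b × e) a ℂ) : EReal :=
  ⨆ (k : ℕ) (_ : 1 ≤ k) (Θ : OneWayLOCC a b (Fin k) (Fin k))
    (_ : ∀ m Y, (Θ.post m Y).IsDiag) (_ : privateError Θ V ≤ ε),
    ((Real.logb 2 (k : ℝ) : ℝ) : EReal)

end PrivateCommunication

end QKey

end

/-! A protocol for `k` messages yields a privacy test that distinguishes `N` from every channel in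
`freeChannels N`. Alice's input is a uniform superposition of messages; the reference keeps the
message, the label and the Kraus index of her instrument. The test compares the reference's message
with Bob's decoded one and, on a common value `x`, applies a contraction `Q x` to Bob's Kraus
register and the rest of the reference. Its operator is `k^{-1/2} ∑ ⟨x x| ⊗ Q x`.

Privacy makes the test pass on `N`. In the spirit of Uhlmann's theorem, root fidelities are traces
against contractions, and their average over messages is bounded by an amplitude of the test.
Maximising jointly over the contractions and the eavesdropper's side gives one family `Q` that
passes with probability at least `1 - ε` (`exists_test_of_privateError_le`).

Monogamy makes the test fail on `M` in `freeChannels N`. The channel behind `M` serves Bob and a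
copy of Bob at once. Let `A` and `B` be the test with Bob and with the copy. On the range of `A†`
Bob's key equals the reference's key, and `B` forces the copy's key to agree too; a single key value
survives, so the two factors `k^{-1/2}` give `‖B A†‖ ≤ 1/k` (`nsq_testOp_swapBob_testAdj_le`). A
unit vector `ω` with `‖A ω‖² ≥ 1 - ε` is close to that range, so
`norm_sq_le_of_norm_comp_adjoint_le` bounds `‖B ω‖²` by `(1/k + √ε)²` and by `1/k² + √ε`. Both
therefore bound `Jmin` (`Jmin_le_of_privateError_le`), and solving for `log k` gives the two
capacity bounds. -/

noncomputable section

namespace QKey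

/-! ### Two nearly incompatible contractions on a Hilbert space -/

section Hilbert

variable {E F G : Type*} [NormedAddCommGroup E] [InnerProductSpace ℂ E]
  [NormedAddCommGroup F] [InnerProductSpace ℂ F] [NormedAddCommGroup G] [InnerProductSpace ℂ G]

/-- For a contraction `B`, the operator `2 B† B - 1` is a contraction. -/
lemma sq_two_mul_re_inner_sub_le (B : E →ₗ[ℂ] G) (hB : ∀ v, ‖B v‖ ≤ ‖v‖) (x y : E) :
    (2 * (inner ℂ (B x) (B y)).re - (inner ℂ x y).re) ^ 2 ≤ ‖x‖ ^ 2 * ‖y‖ ^ 2 := by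
  -- Sum of `‖tx + y‖² - ‖B(tx + y)‖² ≥ 0` and `‖B(tx - y)‖² ≥ 0`; the claim is that this quadratic
  -- in `t` has nonpositive discriminant.
  have key : ∀ t : ℝ, 0 ≤ ‖x‖ ^ 2 * (t * t)
      + (-2 * (2 * (inner ℂ (B x) (B y)).re - (inner ℂ x y).re)) * t + ‖y‖ ^ 2 := by
    intro t
    have h1 : 0 ≤ ‖B ((t : ℂ) • x) - B y‖ ^ 2 := by positivity
    have h2 : ‖B ((t : ℂ) • x + y)‖ ^ 2 ≤ ‖(t : ℂ) • x + y‖ ^ 2 :=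
      pow_le_pow_left₀ (norm_nonneg _) (hB _) 2
    rw [map_add] at h2
    rw [@norm_sub_sq ℂ] at h1
    rw [@norm_add_sq ℂ, @norm_add_sq ℂ] at h2
    simp only [map_smul, norm_smul, inner_smul_left, Complex.conj_ofReal, RCLike.re_to_complex,
      Complex.re_ofReal_mul, Complex.norm_real, mul_pow, Real.norm_eq_abs, sq_abs] at h1 h2
    nlinarith
  have := discrim_le_zero key
  unfold discrim at this
  nlinarith

lemma re_inner_add_sub (x y : E) :
    (inner ℂ (x + y) (x - y)).re = ‖x‖ ^ 2 - ‖y‖ ^ 2 := by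
  have h := inner_re_symm (𝕜 := ℂ) x y
  have hx := inner_self_eq_norm_sq (𝕜 := ℂ) x
  have hy := inner_self_eq_norm_sq (𝕜 := ℂ) y
  simp only [RCLike.re_to_complex] at h hx hy
  rw [inner_add_left, inner_sub_right, inner_sub_right, ← hx, ← hy]
  simp only [Complex.add_re, Complex.sub_re]
  linarith

/-- If `A ω` has almost full norm, where `A` is a contraction with adjoint `A'`, and if `B A'` is
small, then `B ω` is small. -/
lemma norm_sq_le_of_norm_comp_adjoint_le (A : E →ₗ[ℂ] F) (A' : F →ₗ[ℂ] E) (B : E →ₗ[ℂ] G)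
    (hadj : ∀ ψ v, inner ℂ ψ (A v) = inner ℂ (A' ψ) v)
    (hA : ∀ ψ, ‖A' ψ‖ ≤ ‖ψ‖) (hB : ∀ v, ‖B v‖ ≤ ‖v‖) {κ : ℝ} (hκ : 0 ≤ κ)
    (hBA : ∀ ψ, ‖B (A' ψ)‖ ≤ κ * ‖ψ‖) {ε : ℝ} (hε : 0 ≤ ε) {ω : E} (hω : ‖ω‖ = 1)
    (hAω : 1 - ε ≤ ‖A ω‖ ^ 2) :
    ‖B ω‖ ^ 2 ≤ (κ + √ε) ^ 2 ∧ ‖B ω‖ ^ 2 ≤ κ ^ 2 + √ε := by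
  have hsε : √ε ^ 2 = ε := Real.sq_sqrt hε
  have hsε0 := Real.sqrt_nonneg ε
  have hAc : ‖A ω‖ ≤ 1 := by
    have h := hadj (A ω) ω
    have h1 : ‖A ω‖ ^ 2 ≤ ‖A ω‖ := by
      rw [← @inner_self_eq_norm_sq ℂ, h]
      calc _ ≤ ‖inner ℂ (A' (A ω)) ω‖ := RCLike.re_le_norm _
        _ ≤ ‖A' (A ω)‖ * ‖ω‖ := norm_inner_le_norm _ _
        _ ≤ ‖A ω‖ := by rw [hω, mul_one]; exact hA _
    nlinarith [norm_nonneg (A ω)]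
  constructor
  -- Expanding, `‖ω - A'Aω‖² = 1 - 2‖Aω‖² + ‖A'Aω‖² ≤ 1 - ‖Aω‖² ≤ ε`.
  · have h1 : ‖ω - A' (A ω)‖ ≤ √ε := by
      apply Real.le_sqrt_of_sq_le
      have h2 : RCLike.re (inner ℂ ω (A' (A ω))) = ‖A ω‖ ^ 2 := by
        rw [← inner_conj_symm, RCLike.conj_re, ← hadj, inner_self_eq_norm_sq]
      rw [@norm_sub_sq ℂ, h2, hω]
      have := pow_le_pow_left₀ (norm_nonneg _) (hA (A ω)) 2
      linarith
    have h2 : ‖B ω‖ ≤ κ + √ε := by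
      calc ‖B ω‖ = ‖B (A' (A ω)) + B (ω - A' (A ω))‖ := by rw [← map_add]; congr 2; abel
        _ ≤ κ * ‖A ω‖ + ‖ω - A' (A ω)‖ := (norm_add_le _ _).trans (add_le_add (hBA _) (hB _))
        _ ≤ κ + √ε := by nlinarith
    exact pow_le_pow_left₀ (norm_nonneg _) h2 2
  -- The normalised `A ω`; if `A ω = 0` then `ψ = 0`, and every bound below still holds.
  · set ψ : F := ((‖A ω‖⁻¹ : ℝ) : ℂ) • A ω with hψ
    have hψ1 : ‖ψ‖ ≤ 1 := by
      rw [hψ, norm_smul, Complex.norm_real, norm_inv, norm_norm]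
      exact inv_mul_le_one
    set u := A' ψ with hu
    set c := ‖A ω‖ with hc
    have hc0 : 0 ≤ c := norm_nonneg _
    have hcu : RCLike.re (inner ℂ u ω) = c := by
      rw [hu, ← hadj, hψ, inner_smul_left, Complex.conj_ofReal, inner_self_eq_norm_sq_to_K]
      simp only [RCLike.re_to_complex, Complex.coe_algebraMap]
      rw [← Complex.ofReal_pow, ← Complex.ofReal_mul, Complex.ofReal_re, ← hc]
      rcases eq_or_ne c 0 with h | h
      · simp [h]
      · field_simp
    have hn1 : ‖u‖ ≤ 1 := (hA ψ).trans hψ1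
    have hcn : c ≤ ‖u‖ := by
      rw [← hcu]
      calc _ ≤ ‖inner ℂ u ω‖ := RCLike.re_le_norm _
        _ ≤ ‖u‖ * ‖ω‖ := norm_inner_le_norm _ _
        _ = ‖u‖ := by rw [hω, mul_one]
    have hBu : ‖B u‖ ^ 2 ≤ κ ^ 2 :=
      pow_le_pow_left₀ (norm_nonneg _) ((hBA ψ).trans (by nlinarith)) 2
    -- With `ω ± u` the inner product becomes `‖Bω‖² - ‖Bu‖²`. This compares the two outcomes as the
    -- trace distance of `ω` and `u` would, and avoids the cross term of the triangle inequality.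
    have key := sq_two_mul_re_inner_sub_le B hB (ω + u) (ω - u)
    rw [map_add, map_sub] at key
    rw [re_inner_add_sub, re_inner_add_sub, @norm_add_sq ℂ, @norm_sub_sq ℂ, hω, ← inner_conj_symm,
      RCLike.conj_re, hcu] at key
    set n := ‖u‖ ^ 2 with hn
    set q := 2 * (‖B ω‖ ^ 2 - ‖B u‖ ^ 2) - (1 ^ 2 - n) with hq
    have hn1' : n ≤ 1 := by rw [hn]; exact pow_le_one₀ (norm_nonneg _) hn1
    have hcn' : c ^ 2 ≤ n := pow_le_pow_left₀ hc0 hcn 2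
    set s := √(1 - c ^ 2) with hs
    have hs0 : 0 ≤ s := Real.sqrt_nonneg _
    have hs2 : s ^ 2 = 1 - c ^ 2 := Real.sq_sqrt (by linarith)
    have hs1 : s ≤ 1 := by nlinarith
    have hsε' : s ≤ √ε := Real.sqrt_le_sqrt (by linarith)
    -- `key` reads `q² ≤ (1 + n)² - 4c²`, which falls short of `(2s - (1 - n))²` by `4(1 - n)(1 - s)
    -- ≥ 0`.
    have hq' : q ≤ 2 * s - (1 - n) := by
      refine (abs_le_of_sq_le_sq' ?_ (by nlinarith)).2
      nlinarith [mul_nonneg (sub_nonneg.2 hn1') (sub_nonneg.2 hs1)]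
    linarith

end Hilbert

/-! ### Rectangular contractions and a variational form of the fidelity -/

section Contractions

variable {m n p : Type*} [Fintype m] [Fintype n] [Fintype p]

/-- The squared Euclidean norm. -/
def nsq (v : n → ℂ) : ℝ := ∑ i, ‖v i‖ ^ 2

lemma nsq_eq (v : n → ℂ) : nsq v = ‖WithLp.toLp 2 v‖ ^ 2 := by
  rw [EuclideanSpace.norm_sq_eq]; rfl

lemma nsq_nonneg (v : n → ℂ) : 0 ≤ nsq v := by rw [nsq_eq]; positivity

lemma nsq_eq_dotProduct (v : n → ℂ) : ((nsq v : ℝ) : ℂ) = star v ⬝ᵥ v := by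
  simp only [nsq, dotProduct, Pi.star_apply, Complex.star_def, Complex.conj_mul']
  push_cast; rfl

lemma norm_dotProduct_sq_le (v w : n → ℂ) : ‖v ⬝ᵥ w‖ ^ 2 ≤ nsq v * nsq w := by
  have h := norm_inner_le_norm (𝕜 := ℂ) (WithLp.toLp 2 (star v)) (WithLp.toLp 2 w)
  have h2 : inner ℂ (WithLp.toLp 2 (star v)) (WithLp.toLp 2 w) = v ⬝ᵥ w := by
    rw [EuclideanSpace.inner_toLp_toLp, star_star, dotProduct_comm]
  have h3 : nsq v = nsq (star v) := by simp [nsq]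
  rw [h3, nsq_eq, nsq_eq, ← mul_pow, ← h2]
  exact pow_le_pow_left₀ (norm_nonneg _) h 2

/-- Contractions, as rectangular matrices. -/
def Contr (Q : Matrix m n ℂ) : Prop := ∀ v, nsq (Q.mulVec v) ≤ nsq v

lemma Contr.mul {Q : Matrix m n ℂ} {R : Matrix n p ℂ} (hQ : Contr Q) (hR : Contr R) :
    Contr (Q * R) := fun v => by
  rw [← Matrix.mulVec_mulVec]; exact (hQ _).trans (hR v)

lemma Contr.conjTranspose {Q : Matrix m n ℂ} (hQ : Contr Q) : Contr Q.conjTranspose := fun v => by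
  have h1 : ((nsq (Q.conjTranspose.mulVec v) : ℝ) : ℂ)
      = star v ⬝ᵥ Q.mulVec (Q.conjTranspose.mulVec v) := by
    rw [nsq_eq_dotProduct, Matrix.star_mulVec, Matrix.conjTranspose_conjTranspose,
      Matrix.dotProduct_mulVec, Matrix.dotProduct_mulVec, Matrix.dotProduct_mulVec]
  have h2 := norm_dotProduct_sq_le (star v) (Q.mulVec (Q.conjTranspose.mulVec v))
  have h3 : nsq (star v) = nsq v := by simp [nsq]
  rw [← h1, Complex.norm_real, Real.norm_eq_abs, sq_abs, h3] at h2
  have h4 := hQ (Q.conjTranspose.mulVec v)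
  have h5 := nsq_nonneg v
  have h6 := nsq_nonneg (Q.conjTranspose.mulVec v)
  nlinarith

lemma Contr.of_conjTranspose {Q : Matrix m n ℂ} (hQ : Contr Q.conjTranspose) : Contr Q := by
  simpa using hQ.conjTranspose

lemma Contr.transpose {Q : Matrix m n ℂ} (hQ : Contr Q) : Contr Q.transpose := by
  refine Contr.of_conjTranspose fun v => ?_
  have h := hQ (star v)
  have e : Q.mulVec (star v) = star (Q.transpose.conjTranspose.mulVec v) := by
    rw [Matrix.star_mulVec, Matrix.conjTranspose_conjTranspose, Matrix.vecMul_transpose]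
  rw [e] at h
  simpa [nsq] using h

/-- Makes `Q†Q` an admissible test operator in `hypTestError`. -/
lemma Contr.posSemidef_one_sub [DecidableEq n] {Q : Matrix m n ℂ} (hQ : Contr Q) :
    (1 - Q.conjTranspose * Q).PosSemidef := by
  refine Matrix.PosSemidef.of_dotProduct_mulVec_nonneg ?_ fun v => ?_
  · exact Matrix.isHermitian_one.sub (Matrix.isHermitian_conjTranspose_mul_self Q)
  · have : star v ⬝ᵥ (1 - Q.conjTranspose * Q).mulVec v
        = ((nsq v - nsq (Q.mulVec v) : ℝ) : ℂ) := by
      rw [Matrix.sub_mulVec, dotProduct_sub, Matrix.one_mulVec, ← Matrix.mulVec_mulVec]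
      push_cast
      rw [nsq_eq_dotProduct, nsq_eq_dotProduct, Matrix.star_mulVec, Matrix.dotProduct_mulVec _ Q]
      simp [Matrix.dotProduct_mulVec]
    rw [this]
    exact_mod_cast sub_nonneg.2 (hQ v)

lemma Contr.norm_apply_le [DecidableEq n] {Q : Matrix m n ℂ} (hQ : Contr Q) (i : m) (j : n) :
    ‖Q i j‖ ≤ 1 := by
  have h := hQ (Pi.single j 1)
  have h1 : nsq (Pi.single j (1 : ℂ)) = 1 := by
    simp [nsq, Pi.single_apply, apply_ite (fun z : ℂ => ‖z‖)]
  rw [h1, Matrix.mulVec_single_one] at h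
  have h2 : ‖Q i j‖ ^ 2 ≤ 1 :=
    (Finset.single_le_sum (f := fun i => ‖Q i j‖ ^ 2) (fun _ _ => by positivity)
      (Finset.mem_univ i)).trans h
  nlinarith [norm_nonneg (Q i j)]

lemma isClosed_contr : IsClosed {Q : Matrix m n ℂ | Contr Q} := by
  have : {Q : Matrix m n ℂ | Contr Q} = ⋂ v, {Q | nsq (Q.mulVec v) ≤ nsq v} := by
    ext; simp [Contr]
  rw [this]
  refine isClosed_iInter fun v => isClosed_le ?_ continuous_const
  unfold nsq Matrix.mulVec dotProduct
  fun_prop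

/-- Provides the maximiser that replaces a minimax theorem in `exists_test_of_privateError_le`. -/
lemma isCompact_contr : IsCompact {Q : Matrix m n ℂ | Contr Q} := by
  classical
  have h : IsCompact (Set.univ.pi fun _ : m => Set.univ.pi fun _ : n =>
      Metric.closedBall (0 : ℂ) 1) :=
    isCompact_univ_pi fun _ => isCompact_univ_pi fun _ => isCompact_closedBall _ _
  refine IsCompact.of_isClosed_subset h isClosed_contr fun Q hQ => ?_
  exact fun i _ j _ => mem_closedBall_zero_iff.2 (Contr.norm_apply_le hQ i j)

/-- Two operators `S`, `X` with `S†S = X†X` are related by a contraction. -/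
lemma exists_contr_of_conjTranspose_mul_self_eq {S : Matrix p n ℂ} {X : Matrix m n ℂ}
    (h : S.conjTranspose * S = X.conjTranspose * X) :
    ∃ U : Matrix p m ℂ, Contr U ∧ S = U * X := by
  classical
  have hn : ∀ v, nsq (S.mulVec v) = nsq (X.mulVec v) := by
    intro v
    have : ((nsq (S.mulVec v) : ℝ) : ℂ) = nsq (X.mulVec v) := by
      rw [nsq_eq_dotProduct, nsq_eq_dotProduct, Matrix.star_mulVec, Matrix.star_mulVec,
        ← Matrix.dotProduct_mulVec, ← Matrix.dotProduct_mulVec, Matrix.mulVec_mulVec,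
        Matrix.mulVec_mulVec, h]
    exact_mod_cast this
  set f := Matrix.toEuclideanLin X
  set g := Matrix.toEuclideanLin S
  have hfg : ∀ v, ‖g v‖ = ‖f v‖ := fun v => by
    have := hn v.ofLp
    rw [nsq_eq, nsq_eq] at this
    exact (pow_left_inj₀ (norm_nonneg _) (norm_nonneg _) two_ne_zero).1 this
  have hker : LinearMap.ker f ≤ LinearMap.ker g := fun v hv => by
    rw [LinearMap.mem_ker] at hv ⊢
    rw [← norm_eq_zero, hfg, hv, norm_zero]
  -- Equal norms let `g` factor isometrically through the range of `f`; composing with the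
  -- orthogonal projection extends the factor to a contraction on the whole space.
  let k : LinearMap.range f →ₗ[ℂ] EuclideanSpace ℂ p :=
    ((LinearMap.ker f).liftQ g hker).comp f.quotKerEquivRange.symm.toLinearMap
  have hk : ∀ v, k ⟨f v, LinearMap.mem_range_self f v⟩ = g v := by
    intro v
    have : f.quotKerEquivRange.symm ⟨f v, LinearMap.mem_range_self f v⟩
        = (LinearMap.ker f).mkQ v := f.quotKerEquivRange_symm_apply_image v _
    simp [k, this]
  let u : EuclideanSpace ℂ m →ₗ[ℂ] EuclideanSpace ℂ p :=
    k.comp (LinearMap.range f).orthogonalProjectionOnto.toLinearMap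
  have hu : ∀ w, ‖u w‖ ≤ ‖w‖ := by
    intro w
    obtain ⟨v, hv⟩ := ((LinearMap.range f).orthogonalProjectionOnto w).2
    have e : (LinearMap.range f).orthogonalProjectionOnto w
        = ⟨f v, LinearMap.mem_range_self f v⟩ := Subtype.ext hv.symm
    calc ‖u w‖ = ‖f v‖ := by simp only [u, LinearMap.comp_apply, ContinuousLinearMap.coe_coe]
                             rw [e, hk, hfg]
      _ = ‖(LinearMap.range f).orthogonalProjectionOnto w‖ := by rw [e]; rfl
      _ ≤ ‖w‖ := Submodule.norm_orthogonalProjectionOnto_apply_le _ _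
  have huf : ∀ v, u (f v) = g v := by
    intro v
    simp only [u, LinearMap.comp_apply, ContinuousLinearMap.coe_coe]
    rw [← hk]
    congr 1
    exact Submodule.orthogonalProjectionOnto_mem_subspace_eq_self
      (⟨f v, LinearMap.mem_range_self f v⟩ : LinearMap.range f)
  refine ⟨Matrix.toEuclideanLin.symm u, fun v => ?_, ?_⟩
  · have e : WithLp.toLp 2 ((Matrix.toEuclideanLin.symm u).mulVec v) = u (WithLp.toLp 2 v) := by
      conv_rhs => rw [← LinearEquiv.apply_symm_apply Matrix.toEuclideanLin u]
      rfl
    rw [nsq_eq, nsq_eq, e]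
    exact pow_le_pow_left₀ (norm_nonneg _) (hu _) 2
  · apply Matrix.toEuclideanLin.injective
    ext1 v
    have e := huf v
    conv_lhs at e => rw [← LinearEquiv.apply_symm_apply Matrix.toEuclideanLin u]
    rw [← e]
    simp [f, Matrix.toLpLin_apply]

/-- The square root of the fidelity of `C†C` and `Y†Y` is `Tr[Q C Y†]` for a contraction `Q`. -/
lemma exists_contr_fidelity_eq [DecidableEq n] (C : Matrix m n ℂ) (Y : Matrix p n ℂ) :
    ∃ Q : Matrix p m ℂ, Contr Q ∧ 0 ≤ (Q * C * Y.conjTranspose).trace.re ∧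
      fidelity (C.conjTranspose * C) (Y.conjTranspose * Y)
        = (Q * C * Y.conjTranspose).trace.re ^ 2 := by
  set ω := Y.conjTranspose * Y with hω
  have hω0 : 0 ≤ ω := (Matrix.posSemidef_conjTranspose_mul_self Y).nonneg
  set B := CFC.sqrt ω with hB
  have hB2 : B * B = ω := CFC.sqrt_mul_sqrt_self ω hω0
  have hBH : B.conjTranspose = B := (Matrix.nonneg_iff_posSemidef.1 (CFC.sqrt_nonneg ω)).isHermitian
  set T := B * (C.conjTranspose * C) * B with hT
  have hT' : T = (C * B).conjTranspose * (C * B) := by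
    rw [Matrix.conjTranspose_mul, hBH, hT]; simp only [Matrix.mul_assoc]
  have hT0 : 0 ≤ T := by
    rw [hT']; exact (Matrix.posSemidef_conjTranspose_mul_self _).nonneg
  set R := CFC.sqrt T with hR
  have hR2 : R * R = T := CFC.sqrt_mul_sqrt_self T hT0
  have hR0 : R.PosSemidef := Matrix.nonneg_iff_posSemidef.1 (CFC.sqrt_nonneg T)
  -- Polar decompositions `R = U C B` and `B = W Y` turn `Tr R` into `Tr[W†U C Y†]`.
  obtain ⟨U, hU, hUe⟩ := exists_contr_of_conjTranspose_mul_self_eq (S := R) (X := C * B)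
    (by rw [hR0.isHermitian.eq, hR2, hT'])
  obtain ⟨W, hW, hWe⟩ := exists_contr_of_conjTranspose_mul_self_eq (S := B) (X := Y)
    (by rw [hBH, hB2])
  have key : R.trace = (W.conjTranspose * U * C * Y.conjTranspose).trace := by
    have : B = Y.conjTranspose * W.conjTranspose := by
      rw [← Matrix.conjTranspose_mul, ← hWe, hBH]
    rw [hUe, this, ← Matrix.mul_assoc, ← Matrix.mul_assoc, Matrix.trace_mul_comm]
    simp only [Matrix.mul_assoc]
  refine ⟨W.conjTranspose * U, hW.conjTranspose.mul hU, ?_, ?_⟩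
  · rw [← key]
    exact (Complex.le_def.1 hR0.trace_nonneg).1
  · rw [← key]; rfl

end Contractions

/-! ### Transfer to plain function spaces -/

section Functions

variable {m n p : Type*} [Fintype m] [Fintype n] [Fintype p]

/-- Cauchy–Schwarz applied to `‖Av‖² = ⟨A'Av, v⟩`. -/
lemma nsq_le_of_adjoint_le (A : (n → ℂ) → (p → ℂ)) (A' : (p → ℂ) → (n → ℂ))
    (hadj : ∀ ψ v, star ψ ⬝ᵥ A v = star (A' ψ) ⬝ᵥ v) (hA : ∀ ψ, nsq (A' ψ) ≤ nsq ψ) (v : n → ℂ) :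
    nsq (A v) ≤ nsq v := by
  have h1 := norm_dotProduct_sq_le (star (A' (A v))) v
  have h3 : nsq (star (A' (A v))) = nsq (A' (A v)) := by simp [nsq]
  rw [← hadj, ← nsq_eq_dotProduct, Complex.norm_real, Real.norm_eq_abs, sq_abs, h3] at h1
  have h4 := hA (A v)
  have h5 := nsq_nonneg v
  have h6 := nsq_nonneg (A v)
  nlinarith

lemma nsq_le_of_nsq_comp_adjoint_le (A : (n → ℂ) →ₗ[ℂ] (p → ℂ)) (A' : (p → ℂ) →ₗ[ℂ] (n → ℂ))
    (B : (n → ℂ) →ₗ[ℂ] (m → ℂ)) (hadj : ∀ ψ v, star ψ ⬝ᵥ A v = star (A' ψ) ⬝ᵥ v)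
    (hA : ∀ ψ, nsq (A' ψ) ≤ nsq ψ) (hB : ∀ v, nsq (B v) ≤ nsq v) {κ : ℝ} (hκ : 0 ≤ κ)
    (hBA : ∀ ψ, nsq (B (A' ψ)) ≤ κ ^ 2 * nsq ψ) {ε : ℝ} (hε : 0 ≤ ε) {ω : n → ℂ} (hω : nsq ω = 1)
    (hAω : 1 - ε ≤ nsq (A ω)) :
    nsq (B ω) ≤ (κ + √ε) ^ 2 ∧ nsq (B ω) ≤ κ ^ 2 + √ε := by
  have h := norm_sq_le_of_norm_comp_adjoint_le
    ((WithLp.linearEquiv 2 ℂ _).symm.toLinearMap ∘ₗ A ∘ₗ (WithLp.linearEquiv 2 ℂ _).toLinearMap)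
    ((WithLp.linearEquiv 2 ℂ _).symm.toLinearMap ∘ₗ A' ∘ₗ (WithLp.linearEquiv 2 ℂ _).toLinearMap)
    ((WithLp.linearEquiv 2 ℂ _).symm.toLinearMap ∘ₗ B ∘ₗ (WithLp.linearEquiv 2 ℂ _).toLinearMap)
    (fun ψ v => ?_) (fun ψ => ?_) (fun v => ?_) hκ (fun ψ => ?_) hε (ω := WithLp.toLp 2 ω) ?_ ?_
  · rw [nsq_eq]; exact h
  · have := hadj ψ.ofLp v.ofLp
    rw [dotProduct_comm, dotProduct_comm _ v.ofLp] at this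
    exact this
  · have := hA ψ.ofLp
    rw [nsq_eq, nsq_eq] at this
    exact le_of_sq_le_sq this (norm_nonneg _)
  · have := hB v.ofLp
    rw [nsq_eq, nsq_eq] at this
    exact le_of_sq_le_sq this (norm_nonneg _)
  · have := hBA ψ.ofLp
    rw [nsq_eq, nsq_eq, ← mul_pow] at this
    exact le_of_sq_le_sq this (by positivity)
  · rw [nsq_eq] at hω
    nlinarith [norm_nonneg (WithLp.toLp 2 ω)]
  · rw [nsq_eq] at hAω; exact hAω

end Functions

/-! ### The privacy test and its monogamy -/

section KeyTest

variable {K R S W Z Y : Type*} [Fintype K] [Fintype R] [Fintype S] [Fintype W] [Fintype Z]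
  [Fintype Y]

/-- The operator `|K|^{-1/2} ∑_x ⟨x x| ⊗ Q_x` of a privacy test. -/
def testOp (Q : K → Matrix Z (S × R) ℂ) : (K × R × (K × S) × W → ℂ) →ₗ[ℂ] (Z × W → ℂ) where
  toFun v q := ((√(Fintype.card K))⁻¹ : ℝ) *
    ∑ x, ∑ s, ∑ r, Q x q.1 (s, r) * v (x, r, (x, s), q.2)
  map_add' v w := by ext q; simp [mul_add, Finset.sum_add_distrib]
  map_smul' c v := by
    ext q
    simp only [Pi.smul_apply, RingHom.id_apply, smul_eq_mul, Finset.mul_sum]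
    simp only [mul_left_comm]

lemma sq_inv_sqrt_card [Nonempty K] :
    ‖(((√(Fintype.card K))⁻¹ : ℝ) : ℂ)‖ ^ 2 = (Fintype.card K : ℝ)⁻¹ := by
  rw [Complex.norm_real, Real.norm_eq_abs, sq_abs, inv_pow, Real.sq_sqrt (by positivity)]

/-- The exchange of the two systems that hold the key and the shield of Bob and of his copy. -/
def swapBob : (K × R × Y × Y × W → ℂ) →ₗ[ℂ] (K × R × Y × Y × W → ℂ) where
  toFun v h := v (h.1, h.2.1, h.2.2.2.1, h.2.2.1, h.2.2.2.2)
  map_add' _ _ := rfl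
  map_smul' _ _ := rfl

lemma nsq_swapBob (v : K × R × Y × Y × W → ℂ) : nsq (swapBob v) = nsq v := by
  simp only [nsq, swapBob, Fintype.sum_prod_type, LinearMap.coe_mk, AddHom.coe_mk]
  refine Finset.sum_congr rfl fun x _ => Finset.sum_congr rfl fun r _ => ?_
  simp only [← Fintype.sum_prod_type']
  exact Fintype.sum_equiv ⟨fun p => (p.2.1, p.1, p.2.2), fun p => (p.2.1, p.1, p.2.2),
    fun _ => rfl, fun _ => rfl⟩ _ _ fun _ => rfl

variable [DecidableEq K]

/-- The adjoint of `testOp`. -/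
def testAdj (Q : K → Matrix Z (S × R) ℂ) : (Z × W → ℂ) →ₗ[ℂ] (K × R × (K × S) × W → ℂ) where
  toFun ψ h := if h.1 = h.2.2.1.1 then ((√(Fintype.card K))⁻¹ : ℝ) *
    ∑ z, star (Q h.1 z (h.2.2.1.2, h.2.1)) * ψ (z, h.2.2.2) else 0
  map_add' v w := by
    ext q
    simp only [Pi.add_apply]
    split_ifs
    · simp [mul_add, Finset.sum_add_distrib]
    · simp
  map_smul' c v := by
    ext q
    simp only [Pi.smul_apply, RingHom.id_apply, smul_eq_mul]
    split_ifs
    · simp only [Finset.mul_sum, mul_left_comm]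
    · simp

lemma testOp_adjoint (Q : K → Matrix Z (S × R) ℂ) (ψ : Z × W → ℂ)
    (v : K × R × (K × S) × W → ℂ) :
    star ψ ⬝ᵥ testOp Q v = star (testAdj Q ψ) ⬝ᵥ v := by
  have perm : ∀ F : Z → W → K → S → R → ℂ, ∑ z, ∑ w, ∑ x, ∑ s, ∑ r, F z w x s r
      = ∑ x, ∑ r, ∑ s, ∑ w, ∑ z, F z w x s r := by
    intro F
    simp only [← Fintype.sum_prod_type']
    exact Fintype.sum_equiv ⟨fun p => (p.2.2.1, p.2.2.2.2, p.2.2.2.1, p.2.1, p.1),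
      fun p => (p.2.2.2.2, p.2.2.2.1, p.1, p.2.2.1, p.2.1), fun _ => rfl, fun _ => rfl⟩ _ _
      fun _ => rfl
  simp only [dotProduct, testOp, testAdj, LinearMap.coe_mk, AddHom.coe_mk,
    Fintype.sum_prod_type, Pi.star_apply, apply_ite star, star_zero, ite_mul, zero_mul,
    Finset.sum_ite_irrel, Finset.sum_const_zero, star_mul', star_sum, Finset.mul_sum,
    Finset.sum_mul, Complex.star_def, Complex.conj_ofReal, Complex.conj_conj,
    Finset.sum_ite_eq, Finset.mem_univ, if_true]
  rw [perm]
  refine Finset.sum_congr rfl fun x _ => Finset.sum_congr rfl fun r _ =>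
    Finset.sum_congr rfl fun s _ => Finset.sum_congr rfl fun w _ => Finset.sum_congr rfl fun z _ => ?_
  ring

/-- Different `x` land in orthogonal blocks `|x x⟩`, so the squared norm is the average over `x` of
the squared norms of `Q x† ψ`. -/
lemma nsq_testAdj_le [Nonempty K] {Q : K → Matrix Z (S × R) ℂ} (hQ : ∀ x, Contr (Q x))
    (ψ : Z × W → ℂ) : nsq (testAdj Q ψ) ≤ nsq ψ := by
  have h : nsq (testAdj Q ψ) = (Fintype.card K : ℝ)⁻¹ *
      ∑ x, ∑ w, nsq ((Q x).conjTranspose.mulVec (fun z => ψ (z, w))) := by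
    simp only [nsq, testAdj, LinearMap.coe_mk, AddHom.coe_mk, Fintype.sum_prod_type,
      apply_ite (fun z : ℂ => ‖z‖ ^ 2), norm_mul, mul_pow, sq_inv_sqrt_card, norm_zero,
      Finset.sum_ite_irrel, ne_eq, OfNat.ofNat_ne_zero, not_false_eq_true, zero_pow,
      Finset.sum_const_zero, Finset.sum_ite_eq, Finset.mem_univ, if_true,
      Matrix.mulVec, dotProduct, Matrix.conjTranspose_apply]
    simp only [Finset.mul_sum (s := Finset.univ (α := K)), Finset.mul_sum (s := Finset.univ (α := W)),
      Finset.mul_sum (s := Finset.univ (α := S)), Finset.mul_sum (s := Finset.univ (α := R))]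
    refine Finset.sum_congr rfl fun x _ => ?_
    have perm : ∀ F : R → S → W → ℝ, ∑ r, ∑ s, ∑ w, F r s w = ∑ w, ∑ s, ∑ r, F r s w := by
      intro F
      rw [Finset.sum_comm_cycle]; refine Finset.sum_congr rfl fun w _ => Finset.sum_comm
    rw [perm]
  have h2 : nsq ψ = ∑ w, nsq (fun z => ψ (z, w)) := by
    simp only [nsq, Fintype.sum_prod_type]; exact Finset.sum_comm
  rw [h, inv_mul_le_iff₀ (by positivity), h2, ← nsmul_eq_mul, ← Finset.card_univ,
    ← Finset.sum_const]
  exact Finset.sum_le_sum fun x _ => Finset.sum_le_sum fun w _ => (hQ x).conjTranspose _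

lemma nsq_testOp_le [Nonempty K] {Q : K → Matrix Z (S × R) ℂ} (hQ : ∀ x, Contr (Q x))
    (v : K × R × (K × S) × W → ℂ) : nsq (testOp Q v) ≤ nsq v :=
  nsq_le_of_adjoint_le _ _ (testOp_adjoint Q) (nsq_testAdj_le hQ) v

/-- The monogamy estimate. The adjoint ties the reference's key to Bob's, and the swapped test ties
it to the key `y` already held by the copy. The sum over keys collapses to `x = y`, which leaves the
scalar `1/|K|` times `Q y` and `Q y†` on different shields, both contractions. -/
lemma nsq_testOp_swapBob_testAdj_le [Nonempty K] {Q : K → Matrix Z (S × R) ℂ}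
    (hQ : ∀ x, Contr (Q x)) (ψ : Z × (K × S) × W → ℂ) :
    nsq (testOp Q (swapBob (testAdj Q ψ))) ≤ ((Fintype.card K : ℝ)⁻¹) ^ 2 * nsq ψ := by
  have h : nsq (testOp Q (swapBob (testAdj Q ψ))) = ((Fintype.card K : ℝ)⁻¹) ^ 2 *
      ∑ y, ∑ s, ∑ e, nsq ((Q y).mulVec fun t =>
        (Q y).conjTranspose.mulVec (fun z => ψ (z, (y, t.1), e)) (s, t.2)) := by
    have e : ∀ z y s e, testOp Q (swapBob (testAdj Q ψ)) (z, (y, s), e)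
        = ((Fintype.card K : ℝ)⁻¹ : ℝ) * (Q y).mulVec (fun t =>
          (Q y).conjTranspose.mulVec (fun z => ψ (z, (y, t.1), e)) (s, t.2)) z := by
      intro z y s e
      simp only [testOp, testAdj, swapBob, LinearMap.coe_mk, AddHom.coe_mk,
        Fintype.sum_prod_type, Matrix.mulVec, dotProduct, Matrix.conjTranspose_apply, mul_ite,
        mul_zero, Finset.sum_ite_irrel, Finset.sum_const_zero, Finset.sum_ite_eq', Finset.mem_univ,
        if_true, mul_left_comm (Q _ _ _), ← Finset.mul_sum]
      rw [← mul_assoc, ← Complex.ofReal_mul, ← mul_inv, Real.mul_self_sqrt (by positivity)]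
    simp only [nsq, Fintype.sum_prod_type, e, norm_mul, mul_pow, Complex.norm_real,
      Real.norm_eq_abs, sq_abs, ← Finset.mul_sum]
    congr 1
    rw [Finset.sum_comm]; refine Finset.sum_congr rfl fun y _ => ?_
    rw [Finset.sum_comm]; refine Finset.sum_congr rfl fun s _ => Finset.sum_comm
  have h2 : nsq ψ = ∑ y, ∑ s, ∑ e, nsq (fun z => ψ (z, (y, s), e)) := by
    simp only [nsq, Fintype.sum_prod_type]
    rw [Finset.sum_comm]; refine Finset.sum_congr rfl fun y _ => ?_
    rw [Finset.sum_comm]; refine Finset.sum_congr rfl fun s _ => Finset.sum_comm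
  rw [h, h2]
  refine mul_le_mul_of_nonneg_left (Finset.sum_le_sum fun y _ => ?_) (by positivity)
  calc _ ≤ ∑ s, ∑ e, nsq fun t : S × R =>
        (Q y).conjTranspose.mulVec (fun z => ψ (z, (y, t.1), e)) (s, t.2) :=
        Finset.sum_le_sum fun s _ => Finset.sum_le_sum fun e _ => hQ y _
    _ = ∑ s, ∑ e, nsq ((Q y).conjTranspose.mulVec fun z => ψ (z, (y, s), e)) := by
        simp only [nsq, Fintype.sum_prod_type]
        rw [Finset.sum_comm, Finset.sum_comm (s := Finset.univ (α := S))]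
        refine Finset.sum_congr rfl fun e _ => ?_
        rw [Finset.sum_comm]
    _ ≤ _ := Finset.sum_le_sum fun s _ => Finset.sum_le_sum fun e _ => (hQ y).conjTranspose _

/-- A state which passes the privacy test with Bob passes the test with Bob's copy with small
probability. -/
lemma nsq_testOp_swapBob_le [Nonempty K] {Q : K → Matrix Z (S × R) ℂ} (hQ : ∀ x, Contr (Q x))
    {ε : ℝ} (hε : 0 ≤ ε) {ω : K × R × (K × S) × (K × S) × W → ℂ} (hω : nsq ω = 1)
    (hA : 1 - ε ≤ nsq (testOp Q ω)) :
    nsq (testOp Q (swapBob ω)) ≤ ((Fintype.card K : ℝ)⁻¹ + √ε) ^ 2 ∧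
      nsq (testOp Q (swapBob ω)) ≤ ((Fintype.card K : ℝ)⁻¹) ^ 2 + √ε := by
  have hB : ∀ v : K × R × (K × S) × (K × S) × W → ℂ, nsq ((testOp Q ∘ₗ swapBob) v) ≤ nsq v :=
    fun v => (nsq_testOp_le hQ _).trans_eq (nsq_swapBob v)
  have hBA := nsq_testOp_swapBob_testAdj_le (W := W) hQ
  have hadj := testOp_adjoint (W := (K × S) × W) Q
  have hA' := nsq_testAdj_le (W := (K × S) × W) hQ
  have hκ : 0 ≤ (Fintype.card K : ℝ)⁻¹ := by positivity
  generalize (Fintype.card K : ℝ)⁻¹ = κ at hBA hκ ⊢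
  exact nsq_le_of_nsq_comp_adjoint_le (testOp Q) (testAdj Q) (testOp Q ∘ₗ swapBob)
    hadj hA' hB hκ hBA hε hω hA

end KeyTest

/-! ### Kraus operators from the Choi matrix -/

section Kraus

variable {a b : Type*} [Fintype a] [DecidableEq a] [Fintype b]

/-- The Kraus representation of a completely positive map. -/
lemma IsCP.exists_kraus {Φ : Matrix a a ℂ →ₗ[ℂ] Matrix b b ℂ} (hΦ : IsCP Φ) :
    ∃ K : a × b → Matrix b a ℂ, ∀ X, Φ X = ∑ t, K t * X * (K t).conjTranspose := by
  classical
  let e := Fintype.equivFin a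
  -- The unnormalised maximally entangled operator. Its image `C` is the Choi matrix, and the
  -- columns of the square root of `C` are the Kraus operators.
  let X : Matrix (Fin (Fintype.card a) × a) (Fin (Fintype.card a) × a) ℂ :=
    Matrix.vecMulVec (fun p => if p.1 = e p.2 then 1 else 0)
      (star (fun p => if p.1 = e p.2 then 1 else 0))
  have hX : X.PosSemidef := Matrix.posSemidef_vecMulVec_self_star _
  have hC := hΦ _ X hX
  set C := (idTensor (Fin (Fintype.card a)) Φ X).submatrix
    (fun p : a × b => (e p.1, p.2)) (fun p : a × b => (e p.1, p.2)) with hCdef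
  have hC' : C.PosSemidef := hC.submatrix _
  have hCe : ∀ i j β γ, C (i, β) (j, γ) = Φ (Matrix.single i j 1) β γ := by
    intro i j β γ
    simp only [hCdef, Matrix.submatrix_apply, idTensor, LinearMap.coe_mk, AddHom.coe_mk,
      Matrix.of_apply]
    refine congrArg (fun Y => Φ Y β γ) ?_
    ext i' j'
    by_cases h1 : i = i' <;> by_cases h2 : j = j' <;>
      simp [X, Matrix.vecMulVec_apply, h1, h2]
  set B := CFC.sqrt C with hB
  have hBB : B * B = C := CFC.sqrt_mul_sqrt_self C hC'.nonneg
  have hBH : B.conjTranspose = B := (Matrix.nonneg_iff_posSemidef.1 (CFC.sqrt_nonneg C)).isHermitian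
  refine ⟨fun t => Matrix.of fun β i => B (i, β) t, fun Y => ?_⟩
  have h1 : ∀ i j β γ, Φ (Matrix.single i j (Y i j)) β γ
      = ∑ t, B (i, β) t * Y i j * star (B (j, γ) t) := by
    intro i j β γ
    have : Matrix.single i j (Y i j) = Y i j • Matrix.single i j (1 : ℂ) := by simp
    rw [this, map_smul, Matrix.smul_apply, ← hCe, ← hBB, Matrix.mul_apply, Finset.smul_sum]
    refine Finset.sum_congr rfl fun t _ => ?_
    rw [← Matrix.conjTranspose_apply, hBH, smul_eq_mul]; ring
  ext β γ
  conv_lhs => rw [Matrix.matrix_eq_sum_single Y]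
  simp only [map_sum, Matrix.sum_apply, h1, Matrix.mul_apply, Finset.sum_mul, Matrix.of_apply,
    Matrix.conjTranspose_apply]
  simp only [← Fintype.sum_prod_type']
  exact Fintype.sum_equiv ⟨fun p => (p.2.2, p.2.1, p.1), fun p => (p.2.2, p.2.1, p.1),
    fun _ => rfl, fun _ => rfl⟩ _ _ fun _ => rfl

end Kraus

/-! ### From type-II errors to `Jmin` -/

section Jmin

variable {a b : Type*} [Fintype a] [Fintype b] [DecidableEq b]

lemma le_negLogTwo {s t : ℝ} (hst : s ≤ t) :
    ((-Real.logb 2 t : ℝ) : EReal) ≤ negLogTwo s := by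
  unfold negLogTwo
  split_ifs with h
  · exact le_top
  · push Not at h
    exact_mod_cast neg_le_neg (Real.logb_le_logb_of_le one_lt_two h hst)

/-- If every channel of `F(N)` can be distinguished from `N` with type-II error at most `t`, then
`J^ε_min(N) ≤ t`. -/
lemma Jmin_le {ε t : ℝ} (ht : 0 < t) {N : Matrix a a ℂ →ₗ[ℂ] Matrix b b ℂ}
    (h : ∀ M ∈ freeChannels N, ∃ (n : ℕ) (ρ : Matrix (Fin n × a) (Fin n × a) ℂ), IsState ρ ∧
      hypTestError ε (idTensor (Fin n) N ρ) (idTensor (Fin n) M ρ) ≤ t) :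
    Jmin ε N ≤ t := by
  have hinf : ((-Real.logb 2 t : ℝ) : EReal)
      ≤ ⨅ M ∈ freeChannels N, smoothMinRelEntChannel ε N M := by
    refine le_iInf₂ fun M hM => ?_
    obtain ⟨n, ρ, hρ, hle⟩ := h M hM
    exact (le_negLogTwo hle).trans (le_iSup_of_le n (le_iSup_of_le ρ
      (le_iSup_of_le hρ le_rfl)))
  unfold Jmin
  split_ifs with hE
  · exact ht.le
  · unfold smoothMinUnextEnt at hE ⊢
    generalize (⨅ M ∈ freeChannels N, smoothMinRelEntChannel ε N M) = d at hE hinf ⊢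
    induction d with
    -- Positivity of `t` gives a finite lower bound on the infimum, which excludes `⊥`.
    | bot => exact absurd (le_bot_iff.1 hinf) (EReal.coe_ne_bot _)
    | top => exact absurd (EReal.coe_mul_top_of_pos (by norm_num)) hE
    | coe r =>
      have hr : -Real.logb 2 t ≤ r := by exact_mod_cast hinf
      rw [← EReal.coe_mul, EReal.toReal_coe]
      calc (2 : ℝ) ^ (-2 * (1 / 2 * r)) ≤ 2 ^ Real.logb 2 t :=
            Real.rpow_le_rpow_of_exponent_le one_le_two (by linarith)
        _ = t := Real.rpow_logb two_pos (by norm_num) ht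

end Jmin

/-! ### Feasible tests bound the type-II error -/

section HypTest

variable {n : Type*} [Fintype n] [DecidableEq n]

lemma trace_mul_re_nonneg {Λ σ : Matrix n n ℂ} (hΛ : Λ.PosSemidef) (hσ : σ.PosSemidef) :
    0 ≤ (Λ * σ).trace.re := by
  have hr2 : CFC.sqrt σ * CFC.sqrt σ = σ := CFC.sqrt_mul_sqrt_self σ hσ.nonneg
  have hrH : (CFC.sqrt σ).conjTranspose = CFC.sqrt σ :=
    (Matrix.nonneg_iff_posSemidef.1 (CFC.sqrt_nonneg σ)).isHermitian
  have h : (Λ * σ).trace = (CFC.sqrt σ * Λ * (CFC.sqrt σ).conjTranspose).trace := by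
    rw [hrH, Matrix.mul_assoc, Matrix.trace_mul_comm (CFC.sqrt σ), Matrix.mul_assoc, hr2]
  rw [h]
  exact (Complex.le_def.1 (hΛ.mul_mul_conjTranspose_same _).trace_nonneg).1

lemma hypTestError_le {ε t : ℝ} {ρ σ Λ : Matrix n n ℂ} (hσ0 : σ.PosSemidef) (h0 : Λ.PosSemidef)
    (h1 : (1 - Λ).PosSemidef) (hρ : 1 - ε ≤ (Λ * ρ).trace.re) (hσ : (Λ * σ).trace.re ≤ t) :
    hypTestError ε ρ σ ≤ t := by
  unfold hypTestError
  -- Positivity of `σ` bounds the set below, as `csInf_le` requires for a real infimum.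
  refine le_trans (csInf_le ⟨0, ?_⟩ ⟨Λ, h0, h1, hρ, rfl⟩) hσ
  rintro _ ⟨Λ', hΛ', -, -, rfl⟩
  exact trace_mul_re_nonneg hΛ' hσ0

/-- References in `smoothMinRelEntChannel` have the form `Fin n`, while the test is built on a
product type; this carries it across the relabelling. -/
lemma hypTestError_submatrix_le {m : Type*} [Fintype m] [DecidableEq m] (f : m ≃ n) {ε t : ℝ}
    {ρ σ Λ : Matrix n n ℂ} (hσ0 : σ.PosSemidef) (h0 : Λ.PosSemidef)
    (h1 : (1 - Λ).PosSemidef) (hρ : 1 - ε ≤ (Λ * ρ).trace.re) (hσ : (Λ * σ).trace.re ≤ t) :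
    hypTestError ε (ρ.submatrix f f) (σ.submatrix f f) ≤ t := by
  have tr : ∀ X : Matrix n n ℂ, (X.submatrix f f).trace = X.trace := fun X =>
    Fintype.sum_equiv f _ _ fun _ => rfl
  refine hypTestError_le (Λ := Λ.submatrix f f) (hσ0.submatrix f) (h0.submatrix f) ?_ ?_ ?_
  · have := h1.submatrix f
    rwa [Matrix.submatrix_sub, Pi.sub_apply, Pi.sub_apply, Matrix.submatrix_one_equiv] at this
  · rwa [Matrix.submatrix_mul_equiv, tr]
  · rwa [Matrix.submatrix_mul_equiv, tr]

end HypTest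

/-! ### Channels acting on purifications -/

section IdTensor

variable {a b r t m : Type*} [Fintype a] [Fintype t] [Fintype m]

lemma trace_idTensor [Fintype b] [Fintype r] {Φ : Matrix a a ℂ →ₗ[ℂ] Matrix b b ℂ} (hΦ : IsTP Φ)
    (X : Matrix (r × a) (r × a) ℂ) : (idTensor r Φ X).trace = X.trace := by
  simp only [Matrix.trace, Fintype.sum_prod_type, Matrix.diag_apply]
  exact Finset.sum_congr rfl fun i _ => hΦ (Matrix.of fun j k => X (i, j) (i, k))

/-- The vector obtained from the purification `Ψ` of a state by a Kraus family `D`. -/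
def krausApply (D : t → Matrix b a ℂ) (Ψ : Matrix (r × a) m ℂ) : Matrix (r × b) (t × m) ℂ :=
  Matrix.of fun p q => ∑ i, D q.1 p.2 i * Ψ (p.1, i) q.2

lemma idTensor_mul_conjTranspose {Φ : Matrix a a ℂ →ₗ[ℂ] Matrix b b ℂ} {D : t → Matrix b a ℂ}
    (hD : ∀ X, Φ X = ∑ s, D s * X * (D s).conjTranspose) (Ψ : Matrix (r × a) m ℂ) :
    idTensor r Φ (Ψ * Ψ.conjTranspose) = krausApply D Ψ * (krausApply D Ψ).conjTranspose := by
  ext p q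
  simp only [idTensor, LinearMap.coe_mk, AddHom.coe_mk, Matrix.of_apply, hD, Matrix.sum_apply,
    Matrix.mul_apply, Matrix.conjTranspose_apply, krausApply, Fintype.sum_prod_type, star_sum,
    star_mul', Finset.sum_mul, Finset.mul_sum]
  refine Finset.sum_congr rfl fun s _ => ?_
  have perm : ∀ F : a → a → m → ℂ, ∑ x, ∑ y, ∑ z, F x y z = ∑ z, ∑ x, ∑ y, F x y z := by
    intro F
    rw [Finset.sum_comm_cycle]
  rw [perm]
  refine Finset.sum_congr rfl fun z _ => Finset.sum_congr rfl fun x _ =>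
    Finset.sum_congr rfl fun y _ => ?_
  ring

/-- The squared Hilbert–Schmidt norm. -/
def hsq [Fintype b] (X : Matrix a b ℂ) : ℝ := nsq fun p : a × b => X p.1 p.2

lemma trace_mul_conjTranspose [Fintype b] (X : Matrix a b ℂ) :
    (X * X.conjTranspose).trace = ((hsq X : ℝ) : ℂ) := by
  simp only [hsq, nsq, Matrix.trace, Matrix.diag_apply, Matrix.mul_apply,
    Matrix.conjTranspose_apply, Fintype.sum_prod_type, Complex.star_def, Complex.mul_conj']
  push_cast; rfl

lemma trace_test [Fintype b] [Fintype r] (T : Matrix r a ℂ) (Ω : Matrix a b ℂ) :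
    (T.conjTranspose * T * (Ω * Ω.conjTranspose)).trace.re = hsq (T * Ω) := by
  have : (T.conjTranspose * T * (Ω * Ω.conjTranspose)).trace
      = ((T * Ω) * (T * Ω).conjTranspose).trace := by
    rw [Matrix.conjTranspose_mul, Matrix.mul_assoc, Matrix.trace_mul_comm]
    simp only [Matrix.mul_assoc]
  rw [this, trace_mul_conjTranspose, Complex.ofReal_re]

end IdTensor

/-! ### The test composed with Bob's decoders -/

section PrivacyTest

variable {K M J S b Z F C : Type*} [Fintype K] [Fintype M] [Fintype J]
  [Fintype S] [Fintype b] [Fintype C]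

/-- The privacy test: Bob applies the isometric extension, given by the Kraus operators `G m s`, of
his decoder `m`, and then `testOp` is applied. -/
def testMatrix (Q : K → Matrix Z (S × (M × J)) ℂ) (G : M → S → Matrix K b ℂ) :
    Matrix Z ((K × (M × J)) × b) ℂ :=
  Matrix.of fun z p => ((√(Fintype.card K))⁻¹ : ℝ) *
    ∑ s, Q p.1.1 z (s, p.1.2) * G p.1.2.1 s p.1.1 p.2

/-- Bob's isometric extension applied to the rows of `Ω`. -/
def dilateRows (G : M → S → Matrix K b ℂ) (Ω : Matrix ((K × (M × J)) × b) F ℂ) :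
    K × (M × J) × (K × S) × F → ℂ :=
  fun h => (G h.2.1.1 h.2.2.1.2).mulVec (fun β => Ω ((h.1, h.2.1), β) h.2.2.2) h.2.2.1.1

lemma testMatrix_mul (Q : K → Matrix Z (S × (M × J)) ℂ) (G : M → S → Matrix K b ℂ)
    (Ω : Matrix ((K × (M × J)) × b) F ℂ) (q : Z × F) :
    (testMatrix Q G * Ω) q.1 q.2 = testOp Q (dilateRows G Ω) q := by
  simp only [testMatrix, dilateRows, testOp, LinearMap.coe_mk, AddHom.coe_mk, Matrix.mul_apply,
    Matrix.of_apply, Matrix.mulVec, dotProduct, Fintype.sum_prod_type, Finset.mul_sum,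
    Finset.sum_mul]
  refine Finset.sum_congr rfl fun x _ => ?_
  have perm : ∀ H : M → J → b → S → ℂ, ∑ m, ∑ j, ∑ β, ∑ s, H m j β s
      = ∑ s, ∑ m, ∑ j, ∑ β, H m j β s := by
    intro H
    simp only [← Fintype.sum_prod_type']
    exact Fintype.sum_equiv ⟨fun p => (p.2.2.2, p.1, p.2.1, p.2.2.1),
      fun p => (p.2.1, p.2.2.1, p.2.2.2, p.1), fun _ => rfl, fun _ => rfl⟩ _ _ fun _ => rfl
  rw [perm]
  refine Finset.sum_congr rfl fun s _ => Finset.sum_congr rfl fun m _ =>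
    Finset.sum_congr rfl fun j _ => Finset.sum_congr rfl fun β _ => ?_
  ring

lemma nsq_dilateRows [Fintype F] {G : M → S → Matrix K b ℂ} (hG : ∀ m v, ∑ s, nsq ((G m s).mulVec v) = nsq v)
    (Ω : Matrix ((K × (M × J)) × b) F ℂ) : nsq (dilateRows G Ω) = hsq Ω := by
  have h1 : nsq (dilateRows G Ω) = ∑ x, ∑ m, ∑ j, ∑ f, ∑ s,
      nsq ((G m s).mulVec fun β => Ω ((x, (m, j)), β) f) := by
    simp only [nsq, dilateRows, Fintype.sum_prod_type]
    refine Finset.sum_congr rfl fun x _ => Finset.sum_congr rfl fun m _ =>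
      Finset.sum_congr rfl fun j _ => ?_
    rw [Finset.sum_comm_cycle]
    exact Finset.sum_congr rfl fun f _ => Finset.sum_comm
  simp only [h1, hG]
  simp only [hsq, nsq, Fintype.sum_prod_type]
  exact Finset.sum_congr rfl fun x _ => Finset.sum_congr rfl fun m _ =>
      Finset.sum_congr rfl fun j _ => Finset.sum_comm

lemma contr_testMatrix [DecidableEq K] [Nonempty K] [Fintype Z]
    {Q : K → Matrix Z (S × (M × J)) ℂ} (hQ : ∀ x, Contr (Q x))
    {G : M → S → Matrix K b ℂ} (hG : ∀ m v, ∑ s, nsq ((G m s).mulVec v) = nsq v) :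
    Contr (testMatrix Q G) := by
  intro v
  have h := nsq_testOp_le hQ (dilateRows G (Matrix.replicateCol Unit v))
  rw [nsq_dilateRows hG] at h
  have h1 : nsq (testOp Q (dilateRows G (Matrix.replicateCol Unit v)))
      = nsq ((testMatrix Q G).mulVec v) := by
    simp only [nsq, ← testMatrix_mul, Fintype.sum_prod_type]
    simp [Matrix.mul_apply, Matrix.mulVec, dotProduct]
  have h2 : hsq (Matrix.replicateCol Unit v) = nsq v := by
    simp only [hsq, nsq]
    rw [Fintype.sum_prod_type]
    simp
  rwa [h1, h2] at h

/-- Bob's isometric extension applied to the copy of Bob's system in the environment, controlled by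
the copy of the label in the environment. -/
def dilateEnv {X : Type*} (G : M → S → Matrix K b ℂ) (v : X × ((b × C) × M) → ℂ) :
    X × ((K × S) × (C × M)) → ℂ :=
  fun h => (G h.2.2.2 h.2.1.2).mulVec (fun β => v (h.1, ((β, h.2.2.1), h.2.2.2))) h.2.1.1

lemma nsq_dilateEnv {X : Type*} [Fintype X] {G : M → S → Matrix K b ℂ}
    (hG : ∀ m v, ∑ s, nsq ((G m s).mulVec v) = nsq v) (v : X × ((b × C) × M) → ℂ) :
    nsq (dilateEnv G v) = nsq v := by
  have h1 : nsq (dilateEnv G v) = ∑ x, ∑ c, ∑ m, ∑ s,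
      nsq ((G m s).mulVec fun β => v (x, ((β, c), m))) := by
    simp only [nsq, dilateEnv, Fintype.sum_prod_type]
    refine Finset.sum_congr rfl fun x _ => ?_
    have perm : ∀ H : K → S → C → M → ℝ, ∑ y, ∑ s, ∑ c, ∑ m, H y s c m
        = ∑ c, ∑ m, ∑ s, ∑ y, H y s c m := by
      intro H
      simp only [← Fintype.sum_prod_type']
      exact Fintype.sum_equiv ⟨fun p => (p.2.2.1, p.2.2.2, p.2.1, p.1),
        fun p => (p.2.2.2, p.2.2.1, p.1, p.2.1), fun _ => rfl, fun _ => rfl⟩ _ _ fun _ => rfl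
    exact perm _
  simp only [h1, hG]
  simp only [nsq, Fintype.sum_prod_type]
  refine Finset.sum_congr rfl fun x _ => ?_
  rw [Finset.sum_comm_cycle, Finset.sum_comm]

/-- A state `Ω Ω†` of the reference and Bob, whose purifying system holds a copy of Bob's system and
a copy of the label: if it passes the privacy test, then the state of the reference and the copy
does not. -/
lemma hsq_testMatrix_mul_swap_le [DecidableEq K] [Nonempty K] [Fintype Z]
    {Q : K → Matrix Z (S × (M × J)) ℂ} (hQ : ∀ x, Contr (Q x))
    {G : M → S → Matrix K b ℂ} (hG : ∀ m v, ∑ s, nsq ((G m s).mulVec v) = nsq v)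
    {Ω Ω' : Matrix ((K × (M × J)) × b) ((b × C) × M) ℂ} (hΩ : hsq Ω = 1)
    (hlabel : ∀ x μ j β f m, μ ≠ m → Ω ((x, (μ, j)), β) (f, m) = 0)
    (hswap : ∀ r β β' c m, Ω' (r, β) ((β', c), m) = Ω (r, β') ((β, c), m))
    {ε : ℝ} (hε : 0 ≤ ε) (hT : 1 - ε ≤ hsq (testMatrix Q G * Ω)) :
    hsq (testMatrix Q G * Ω') ≤ ((Fintype.card K : ℝ)⁻¹ + √ε) ^ 2 ∧
      hsq (testMatrix Q G * Ω') ≤ ((Fintype.card K : ℝ)⁻¹) ^ 2 + √ε := by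
  -- Bob's system and its copy are both decoded: Bob's by the reference's label, the copy by the
  -- environment's label. These isometries preserve the norm and the pass probability.
  let lift : Matrix ((K × (M × J)) × b) ((b × C) × M) ℂ →
      (K × (M × J) × (K × S) × (K × S) × (C × M) → ℂ) := fun Ω h =>
    dilateEnv (X := K × (M × J) × (K × S)) G
      (fun p => dilateRows G Ω (p.1.1, p.1.2.1, p.1.2.2, p.2))
      ((h.1, h.2.1, h.2.2.1), h.2.2.2)
  have hlift : ∀ Ω, nsq (lift Ω) = hsq Ω := by
    intro Ω
    rw [← nsq_dilateRows hG]
    have := nsq_dilateEnv (X := K × (M × J) × (K × S)) hG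
      (fun p => dilateRows G Ω (p.1.1, p.1.2.1, p.1.2.2, p.2))
    simp only [nsq, Fintype.sum_prod_type] at this ⊢
    exact this
  have htest : ∀ Ω, nsq (testOp Q (lift Ω)) = hsq (testMatrix Q G * Ω) := by
    intro Ω
    have h1 : hsq (testMatrix Q G * Ω) = nsq (testOp Q (dilateRows G Ω)) := by
      simp only [hsq, testMatrix_mul]
    rw [h1, ← nsq_dilateEnv hG]
    congr 1
    ext q
    simp only [testOp, lift, dilateEnv, LinearMap.coe_mk, AddHom.coe_mk, Matrix.mulVec, dotProduct,
      Finset.mul_sum]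
    have perm : ∀ H : K → S → M × J → b → ℂ, ∑ x, ∑ s, ∑ r, ∑ β, H x s r β
        = ∑ β, ∑ x, ∑ s, ∑ r, H x s r β := by
      intro H
      simp only [← Fintype.sum_prod_type']
      exact Fintype.sum_equiv ⟨fun p => (p.2.2.2, p.1, p.2.1, p.2.2.1),
        fun p => (p.2.1, p.2.2.1, p.2.2.2, p.1), fun _ => rfl, fun _ => rfl⟩ _ _ fun _ => rfl
    rw [perm]
    refine Finset.sum_congr rfl fun β _ => Finset.sum_congr rfl fun x _ =>
      Finset.sum_congr rfl fun s _ => Finset.sum_congr rfl fun r _ => ?_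
    ring
  have hs : lift Ω' = swapBob (lift Ω) := by
    ext ⟨x, ⟨μ, j⟩, ⟨y, s⟩, ⟨y', s'⟩, ⟨c, m⟩⟩
    simp only [lift, swapBob, dilateEnv, dilateRows, LinearMap.coe_mk, AddHom.coe_mk, hswap,
      Matrix.mulVec, dotProduct, Finset.mul_sum]
    rw [Finset.sum_comm]
    refine Finset.sum_congr rfl fun β _ => Finset.sum_congr rfl fun β' _ => ?_
    -- Exchanging Bob with the copy also exchanges which label controls which decoder; this is
    -- harmless because the amplitude vanishes unless the labels agree.
    rcases eq_or_ne μ m with rfl | h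
    · ring
    · simp [hlabel _ _ _ _ _ _ h]
  rw [← htest, hs]
  exact nsq_testOp_swapBob_le hQ hε ((hlift Ω).trans hΩ) ((htest Ω).symm ▸ hT)

end PrivacyTest

/-! ### Kraus operators of the marginals of a channel -/

section PartialTrace

variable {a b e t : Type*} [Fintype a] [Fintype e] [Fintype t]

/-- The operator `(1 ⊗ ⟨f|) C`. -/
def sliceSnd (C : Matrix (b × e) a ℂ) (f : e) : Matrix b a ℂ := Matrix.of fun β i => C (β, f) i

/-- The operator `(⟨f| ⊗ 1) C`. -/
def sliceFst (C : Matrix (e × b) a ℂ) (f : e) : Matrix b a ℂ := Matrix.of fun β i => C (f, β) i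

lemma traceSnd_conj (C : Matrix (b × e) a ℂ) (X : Matrix a a ℂ) :
    traceSnd (C * X * C.conjTranspose)
      = ∑ f, sliceSnd C f * X * (sliceSnd C f).conjTranspose := by
  ext i j
  simp [traceSnd, sliceSnd, Matrix.sum_apply, Matrix.mul_apply]

lemma traceFst_conj (C : Matrix (e × b) a ℂ) (X : Matrix a a ℂ) :
    traceFst (C * X * C.conjTranspose)
      = ∑ f, sliceFst C f * X * (sliceFst C f).conjTranspose := by
  ext i j
  simp [traceFst, sliceFst, Matrix.sum_apply, Matrix.mul_apply]

lemma traceSnd_kraus (C : t → Matrix (b × e) a ℂ) (X : Matrix a a ℂ) :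
    traceSnd (∑ c, C c * X * (C c).conjTranspose)
      = ∑ p : e × t, sliceSnd (C p.2) p.1 * X * (sliceSnd (C p.2) p.1).conjTranspose := by
  rw [Fintype.sum_prod_type, Finset.sum_comm]
  simp only [← traceSnd_conj]
  ext i j
  simp only [traceSnd, Matrix.sum_apply, Matrix.of_apply]
  exact Finset.sum_comm

lemma traceFst_kraus (C : t → Matrix (e × b) a ℂ) (X : Matrix a a ℂ) :
    traceFst (∑ c, C c * X * (C c).conjTranspose)
      = ∑ p : e × t, sliceFst (C p.2) p.1 * X * (sliceFst (C p.2) p.1).conjTranspose := by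
  rw [Fintype.sum_prod_type, Finset.sum_comm]
  simp only [← traceFst_conj]
  ext i j
  simp only [traceFst, Matrix.sum_apply, Matrix.of_apply]
  exact Finset.sum_comm

end PartialTrace

/-! ### Trace preservation in terms of Kraus operators -/

section Isometry

variable {a b t : Type*} [Fintype a] [Fintype b] [Fintype t]

/-- The Kraus operators of a channel form an isometry. -/
lemma IsTP.sum_nsq_kraus {Φ : Matrix a a ℂ →ₗ[ℂ] Matrix b b ℂ} (hΦ : IsTP Φ)
    {G : t → Matrix b a ℂ} (hG : ∀ X, Φ X = ∑ s, G s * X * (G s).conjTranspose) (v : a → ℂ) :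
    ∑ s, nsq ((G s).mulVec v) = nsq v := by
  have h := hΦ (Matrix.vecMulVec v (star v))
  have h1 : ∀ s, (G s * Matrix.vecMulVec v (star v) * (G s).conjTranspose).trace
      = ((nsq ((G s).mulVec v) : ℝ) : ℂ) := by
    intro s
    rw [Matrix.mul_vecMulVec, Matrix.vecMulVec_mul, Matrix.trace_vecMulVec, nsq_eq_dotProduct,
      Matrix.star_mulVec, dotProduct_comm]
  rw [hG, Matrix.trace_sum, Matrix.trace_vecMulVec, dotProduct_comm, ← nsq_eq_dotProduct] at h
  simp only [h1] at h
  exact_mod_cast h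

end Isometry

/-! ### Alice's input state -/

section ReferenceState

variable {K M J a : Type*} [Fintype K] [Fintype M] [DecidableEq M] [Fintype J] [Fintype a]

/-- A purification of the state on the systems `K M J` of the reference and `A` which Alice prepares
from a uniformly distributed message, if her instrument has the Kraus operators `A m j`. The
purifying system holds a copy of the label. -/
def refVec (A : M → J → Matrix a K ℂ) : Matrix ((K × (M × J)) × a) M ℂ :=
  Matrix.of fun p m => if p.1.2.1 = m then
    ((√(Fintype.card K))⁻¹ : ℝ) * A m p.1.2.2 p.2 p.1.1 else 0

lemma hsq_refVec [Nonempty K] {A : M → J → Matrix a K ℂ}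
    (hA : ∀ x, ∑ m, ∑ j, nsq (fun i => A m j i x) = 1) : hsq (refVec A) = 1 := by
  have h : hsq (refVec A) = ∑ x, (Fintype.card K : ℝ)⁻¹ *
      ∑ m, ∑ j, nsq (fun i => A m j i x) := by
    simp only [hsq, nsq, refVec, Matrix.of_apply, Fintype.sum_prod_type,
      apply_ite (fun z : ℂ => ‖z‖ ^ 2), norm_mul, mul_pow, sq_inv_sqrt_card, norm_zero, ne_eq,
      OfNat.ofNat_ne_zero, not_false_eq_true, zero_pow, Finset.sum_ite_eq, Finset.mem_univ, if_true,
      Finset.mul_sum]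
  simp [h, hA]

lemma isState_refVec [Nonempty K] {A : M → J → Matrix a K ℂ}
    (hA : ∀ x, ∑ m, ∑ j, nsq (fun i => A m j i x) = 1) :
    IsState (refVec A * (refVec A).conjTranspose) :=
  ⟨Matrix.posSemidef_self_mul_conjTranspose _, by
    rw [trace_mul_conjTranspose, hsq_refVec hA, Complex.ofReal_one]⟩

end ReferenceState

/-! ### Cauchy–Schwarz and compactness for the Hilbert–Schmidt norm -/

section Trace

variable {m n : Type*} [Fintype m] [Fintype n]

lemma norm_trace_mul_sq_le (θ : Matrix m n ℂ) (X : Matrix n m ℂ) :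
    ‖(θ * X).trace‖ ^ 2 ≤ hsq θ * hsq X := by
  have h := norm_dotProduct_sq_le (fun p : m × n => θ p.1 p.2) (fun p : m × n => X p.2 p.1)
  have h1 : (fun p : m × n => θ p.1 p.2) ⬝ᵥ (fun p : m × n => X p.2 p.1) = (θ * X).trace := by
    simp [dotProduct, Matrix.trace, Matrix.mul_apply, Fintype.sum_prod_type]
  have h2 : nsq (fun p : m × n => X p.2 p.1) = hsq X := by
    simp only [hsq, nsq, Fintype.sum_prod_type]; exact Finset.sum_comm
  rwa [h1, h2] at h

lemma isCompact_hsq_le_one : IsCompact {θ : Matrix m n ℂ | hsq θ ≤ 1} := by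
  have h : IsCompact (Set.univ.pi fun _ : m => Set.univ.pi fun _ : n =>
      Metric.closedBall (0 : ℂ) 1) :=
    isCompact_univ_pi fun _ => isCompact_univ_pi fun _ => isCompact_closedBall _ _
  refine IsCompact.of_isClosed_subset h ?_ fun θ hθ i _ j _ => ?_
  · refine isClosed_le ?_ continuous_const
    unfold hsq nsq
    fun_prop
  · rw [mem_closedBall_zero_iff]
    have h2 : ‖θ i j‖ ^ 2 ≤ 1 :=
      (Finset.single_le_sum (f := fun p : m × n => ‖θ p.1 p.2‖ ^ 2) (fun _ _ => by positivity)
        (Finset.mem_univ (i, j))).trans hθ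
    nlinarith [norm_nonneg (θ i j)]

end Trace

/-! ### Private communication expressed through the test -/

section Private

variable {a b e : Type*} [Fintype a] [Fintype b] {k : ℕ}
  {J S : Type*} [Fintype J] [Fintype S]

/-- A purification of the joint state of Bob and the eavesdropper, if Alice's instrument has the
Kraus operators `A m j` and Bob's channels have the Kraus operators `G m s`. -/
def privVec {M : Type*} [DecidableEq M] (A : M → J → Matrix a (Fin k) ℂ)
    (G : M → S → Matrix (Fin k) b ℂ) (V : Matrix (b × e) a ℂ) (x : Fin k) :
    Matrix (S × (M × J)) (Fin k × (e × M)) ℂ :=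
  Matrix.of fun t p => if t.2.1 = p.2.2 then
    ∑ β, G p.2.2 t.1 p.1 β * ∑ i, V (β, p.2.1) i * A p.2.2 t.2.2 i x else 0

/-- Tracing out the Kraus registers and the second copy of the label makes the state block diagonal
in the label. The entrywise conjugate gives the form `Y†Y` needed by `exists_contr_fidelity_eq`. -/
lemma bobEveState_eq (Θ : OneWayLOCC a b (Fin k) (Fin k))
    {A : Fin Θ.labels → J → Matrix a (Fin k) ℂ} {G : Fin Θ.labels → S → Matrix (Fin k) b ℂ}
    (hA : ∀ m X, Θ.pre m X = ∑ j, A m j * X * (A m j).conjTranspose)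
    (hG : ∀ m X, Θ.post m X = ∑ s, G m s * X * (G m s).conjTranspose)
    (V : Matrix (b × e) a ℂ) (x : Fin k) :
    bobEveState Θ V (Matrix.single x x 1)
      = ((privVec A G V x).map star).conjTranspose * (privVec A G V x).map star := by
  have hB : ∀ m β f γ g, (V * Θ.pre m (Matrix.single x x 1) * V.conjTranspose) (β, f) (γ, g)
      = ∑ j, (∑ i, V (β, f) i * A m j i x) * star (∑ i, V (γ, g) i * A m j i x) := by
    intro m β f γ g
    have h1 : V * Θ.pre m (Matrix.single x x 1) * V.conjTranspose
        = ∑ j, Matrix.vecMulVec ((V * A m j).mulVec (Pi.single x 1))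
          (star ((V * A m j).mulVec (Pi.single x 1))) := by
      rw [hA, Matrix.mul_sum, Matrix.sum_mul]
      refine Finset.sum_congr rfl fun j _ => ?_
      rw [Matrix.single_eq_single_vecMulVec_single, Matrix.star_mulVec, ← Matrix.vecMulVec_mul,
        ← Matrix.mul_vecMulVec, Matrix.conjTranspose_mul]
      simp [Matrix.mul_assoc]
    rw [h1, Matrix.sum_apply]
    refine Finset.sum_congr rfl fun j _ => ?_
    rw [Matrix.vecMulVec_apply, Pi.star_apply, Matrix.mulVec_single_one]
    rfl
  obtain ⟨w, hw⟩ : ∃ w : Fin Θ.labels → J → b → e → ℂ,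
      ∀ m j β f, ∑ i, V (β, f) i * A m j i x = w m j β f := ⟨_, fun _ _ _ _ => rfl⟩
  ext ⟨y, f, m⟩ ⟨y', g, m'⟩
  simp only [bobEveState, Matrix.of_apply, hG, hB, hw, Matrix.mul_apply, Matrix.conjTranspose_apply,
    Matrix.map_apply, star_star, privVec, Fintype.sum_prod_type, Matrix.sum_apply]
  rcases eq_or_ne m m' with rfl | h
  · simp only [if_true, apply_ite star, star_zero, mul_ite, ite_mul, zero_mul, mul_zero,
      Finset.sum_ite_irrel, Finset.sum_const_zero, Finset.sum_ite_eq', Finset.mem_univ]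
    simp only [star_sum, star_mul', Finset.sum_mul, Finset.mul_sum]
    refine Finset.sum_congr rfl fun s _ => ?_
    rw [Finset.sum_comm_cycle]
    refine Finset.sum_congr rfl fun j _ => ?_
    refine Finset.sum_congr rfl fun β _ => Finset.sum_congr rfl fun γ _ => ?_
    ring
  · rw [if_neg h]
    symm
    refine Finset.sum_eq_zero fun s _ => Finset.sum_eq_zero fun μ _ =>
      Finset.sum_eq_zero fun j _ => ?_
    rcases eq_or_ne μ m with rfl | h'
    · simp [h]
    · simp [h']

/-- The purification on the message `x`, if Bob's output is `x`. -/
def keyVec {M : Type*} [DecidableEq M] (A : M → J → Matrix a (Fin k) ℂ)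
    (G : M → S → Matrix (Fin k) b ℂ) (V : Matrix (b × e) a ℂ) (x : Fin k) :
    Matrix (S × (M × J)) (e × M) ℂ :=
  Matrix.of fun t p => privVec A G V x t (x, p)

/-- One `k^{-1/2}` comes from the test and one from the uniform superposition of messages; together
they turn the test amplitude into an average over messages, to be matched with root fidelities. -/
lemma testMatrix_mul_refVec {M Z : Type*} [Fintype M] [DecidableEq M]
    (A : M → J → Matrix a (Fin k) ℂ) (G : M → S → Matrix (Fin k) b ℂ) (V : Matrix (b × e) a ℂ)
    (Q : Fin k → Matrix Z (S × (M × J)) ℂ) :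
    testMatrix Q G * krausApply (sliceSnd V) (refVec A)
      = ((k : ℂ)⁻¹) • ∑ x, Q x * keyVec A G V x := by
  ext z ⟨f, m⟩
  have hΩ : ∀ x μ j β, krausApply (sliceSnd V) (refVec A) ((x, (μ, j)), β) (f, m)
      = ((√(Fintype.card (Fin k)))⁻¹ : ℝ) *
        (if μ = m then ∑ i, V (β, f) i * A m j i x else 0) := by
    intro x μ j β
    simp only [krausApply, sliceSnd, refVec, Matrix.of_apply]
    split_ifs
    · rw [Finset.mul_sum]; exact Finset.sum_congr rfl fun i _ => by ring
    · simp
  have hc : (((√(Fintype.card (Fin k)))⁻¹ : ℝ) : ℂ) * ((√(Fintype.card (Fin k)))⁻¹ : ℝ)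
      = (k : ℂ)⁻¹ := by
    rw [← Complex.ofReal_mul, ← mul_inv, Real.mul_self_sqrt (by positivity), Fintype.card_fin]
    simp
  rw [testMatrix_mul Q G _ (z, (f, m))]
  simp only [testOp, dilateRows, LinearMap.coe_mk, AddHom.coe_mk, Matrix.mulVec, dotProduct,
    Fintype.sum_prod_type, hΩ, Matrix.smul_apply, Matrix.sum_apply, Matrix.mul_apply, keyVec,
    privVec, Matrix.of_apply, smul_eq_mul, ← hc, mul_assoc]
  congr 1
  rw [Finset.mul_sum]
  refine Finset.sum_congr rfl fun x _ => ?_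
  rw [Finset.mul_sum]
  refine Finset.sum_congr rfl fun s _ => ?_
  rw [Finset.mul_sum]
  refine Finset.sum_congr rfl fun μ _ => ?_
  rw [Finset.mul_sum]
  refine Finset.sum_congr rfl fun j _ => ?_
  split_ifs with h
  · subst h
    rw [mul_left_comm, Finset.mul_sum (a := (((√(Fintype.card (Fin k)))⁻¹ : ℝ) : ℂ))]
    simp only [mul_left_comm]
  · simp

/-- Factoring the ideal state through `⟨x| ⊗ √σ` projects Bob's output onto the correct message, so
only `keyVec` survives in the fidelity. -/
lemma exists_contr_fidelity_bobEveState [Fintype e] [DecidableEq e] (Θ : OneWayLOCC a b (Fin k) (Fin k))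
    {A : Fin Θ.labels → J → Matrix a (Fin k) ℂ} {G : Fin Θ.labels → S → Matrix (Fin k) b ℂ}
    (hA : ∀ m X, Θ.pre m X = ∑ j, A m j * X * (A m j).conjTranspose)
    (hG : ∀ m X, Θ.post m X = ∑ s, G m s * X * (G m s).conjTranspose)
    (V : Matrix (b × e) a ℂ) {σ : Matrix (e × Fin Θ.labels) (e × Fin Θ.labels) ℂ}
    (hσ : σ.PosSemidef) (x : Fin k) :
    ∃ Q : Matrix (e × Fin Θ.labels) (S × (Fin Θ.labels × J)) ℂ, Contr Q ∧
      0 ≤ ((CFC.sqrt σ).transpose * (Q * keyVec A G V x)).trace.re ∧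
      fidelity (Matrix.kronecker (Matrix.single x x (1 : ℂ)) σ)
        (bobEveState Θ V (Matrix.single x x (1 : ℂ)))
        = ((CFC.sqrt σ).transpose * (Q * keyVec A G V x)).trace.re ^ 2 := by
  have hr2 : CFC.sqrt σ * CFC.sqrt σ = σ := CFC.sqrt_mul_sqrt_self σ hσ.nonneg
  have hrH : (CFC.sqrt σ).conjTranspose = CFC.sqrt σ :=
    (Matrix.nonneg_iff_posSemidef.1 (CFC.sqrt_nonneg σ)).isHermitian
  set r := CFC.sqrt σ
  let C : Matrix (e × Fin Θ.labels) (Fin k × (e × Fin Θ.labels)) ℂ :=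
    Matrix.of fun z p => if p.1 = x then r z p.2 else 0
  have hC : Matrix.kronecker (Matrix.single x x (1 : ℂ)) σ = C.conjTranspose * C := by
    ext ⟨y, p⟩ ⟨y', p'⟩
    have h1 : σ p p' = ∑ z, star (r z p) * r z p' := by
      rw [← hr2, Matrix.mul_apply]
      refine Finset.sum_congr rfl fun z _ => ?_
      rw [← Matrix.conjTranspose_apply, hrH]
    rw [Matrix.mul_apply, Matrix.kronecker, Matrix.kroneckerMap_apply, h1]
    simp only [Matrix.single_apply, Matrix.conjTranspose_apply, C, Matrix.of_apply]
    by_cases hy : y = x <;> by_cases hy' : y' = x <;> simp [hy, hy', Ne.symm]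
  obtain ⟨Q, hQ, h0, hF⟩ := exists_contr_fidelity_eq C ((privVec A G V x).map star)
  have key : (Q * C * ((privVec A G V x).map star).conjTranspose).trace
      = (r.transpose * (Q.transpose * keyVec A G V x)).trace := by
    have h1 : C * ((privVec A G V x).map star).conjTranspose
        = r * (keyVec A G V x).transpose := by
      ext z t
      simp only [C, Matrix.mul_apply, Matrix.of_apply, Matrix.conjTranspose_apply, Matrix.map_apply,
        star_star, keyVec, Matrix.transpose_apply, ite_mul, zero_mul]
      rw [Fintype.sum_prod_type]
      simp
    rw [Matrix.mul_assoc, h1, ← Matrix.trace_transpose, Matrix.transpose_mul, Matrix.transpose_mul,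
      Matrix.transpose_transpose, Matrix.mul_assoc, Matrix.trace_mul_comm, Matrix.mul_assoc]
  refine ⟨Q.transpose, hQ.transpose, ?_, ?_⟩
  · rwa [← key]
  · rw [← key, hC, bobEveState_eq Θ hA hG, hF]

end Private

/-! ### The test extracted from a protocol, and the bound on `Jmin` -/

section Main

variable {a b e : Type*} [Fintype a] [Fintype b] [Fintype e] [DecidableEq e] {k : ℕ}

lemma nonempty_isState {n : Type*} [Fintype n] [DecidableEq n] [Nonempty n] :
    Nonempty {σ : Matrix n n ℂ // IsState σ} := by
  obtain ⟨i⟩ := ‹Nonempty n›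
  refine ⟨Matrix.vecMulVec (Pi.single i 1) (star (Pi.single i 1)),
    Matrix.posSemidef_vecMulVec_self_star _, ?_⟩
  simp [Matrix.trace_vecMulVec]

lemma hsq_transpose_sqrt {n : Type*} [Fintype n] [DecidableEq n] {σ : Matrix n n ℂ}
    (hσ : IsState σ) : hsq (CFC.sqrt σ).transpose = 1 := by
  have hr2 : CFC.sqrt σ * CFC.sqrt σ = σ := CFC.sqrt_mul_sqrt_self σ hσ.1.nonneg
  have hrH : (CFC.sqrt σ).conjTranspose = CFC.sqrt σ :=
    (Matrix.nonneg_iff_posSemidef.1 (CFC.sqrt_nonneg σ)).isHermitian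
  have h : ((hsq (CFC.sqrt σ) : ℝ) : ℂ) = 1 := by
    rw [← trace_mul_conjTranspose, hrH, hr2, hσ.2]
  have h2 : hsq (CFC.sqrt σ).transpose = hsq (CFC.sqrt σ) := by
    simp only [hsq, nsq, Fintype.sum_prod_type, Matrix.transpose_apply]; exact Finset.sum_comm
  rw [h2]; exact_mod_cast h

/-- A protocol of private communication with error at most `ε` gives a privacy test which the state
of the reference and Bob passes with probability at least `1 - ε`. -/
lemma exists_test_of_privateError_le {J S : Type*} [Fintype J] [Fintype S]
    (hk : 1 ≤ k) (Θ : OneWayLOCC a b (Fin k) (Fin k))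
    {A : Fin Θ.labels → J → Matrix a (Fin k) ℂ} {G : Fin Θ.labels → S → Matrix (Fin k) b ℂ}
    (hA : ∀ m X, Θ.pre m X = ∑ j, A m j * X * (A m j).conjTranspose)
    (hG : ∀ m X, Θ.post m X = ∑ s, G m s * X * (G m s).conjTranspose)
    (V : Matrix (b × e) a ℂ) [Nonempty (e × Fin Θ.labels)] {ε : ℝ} (hε : privateError Θ V ≤ ε) :
    ∃ Q : Fin k → Matrix (e × Fin Θ.labels) (S × (Fin Θ.labels × J)) ℂ, (∀ x, Contr (Q x)) ∧
      1 - ε ≤ hsq (testMatrix Q G * krausApply (sliceSnd V) (refVec A)) := by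
  classical
  have : NeZero k := ⟨by omega⟩
  have hk0 : (0 : ℝ) < k := by exact_mod_cast hk
  -- The test must not depend on `σ`, so `√σ` is relaxed to any `θ` of Hilbert–Schmidt norm at most
  -- one, and `θ` and `Q` are optimised together.
  let f : Matrix (e × Fin Θ.labels) (e × Fin Θ.labels) ℂ ×
      (Fin k → Matrix (e × Fin Θ.labels) (S × (Fin Θ.labels × J)) ℂ) → ℝ := fun p =>
    ∑ x, (p.1 * (p.2 x * keyVec A G V x)).trace.re
  have hf : Continuous f := by
    refine continuous_finsetSum _ fun x _ => Complex.continuous_re.comp (Continuous.matrix_trace ?_)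
    exact continuous_fst.matrix_mul
      (((continuous_apply x).comp continuous_snd).matrix_mul continuous_const)
  obtain ⟨⟨θ, Q⟩, hmem, hmax⟩ := ((isCompact_hsq_le_one (m := e × Fin Θ.labels)
    (n := e × Fin Θ.labels)).prod (isCompact_univ_pi fun _ : Fin k => isCompact_contr
      (m := e × Fin Θ.labels) (n := S × (Fin Θ.labels × J)))).exists_isMaxOn
    ⟨(0, 0), by simp [hsq, nsq], fun x _ v => by
      simp only [Pi.zero_apply, Matrix.zero_mulVec]; simpa [nsq] using nsq_nonneg v⟩ hf.continuousOn
  have hθ : hsq θ ≤ 1 := hmem.1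
  have hQ : ∀ x, Contr (Q x) := fun x => hmem.2 x (Set.mem_univ x)
  set c := f (θ, Q) / k with hc
  have hbound : 1 - c ^ 2 ≤ privateError Θ V := by
    have := nonempty_isState (n := e × Fin Θ.labels)
    refine le_ciInf fun σ => ?_
    choose R hR h0 hF using exists_contr_fidelity_bobEveState Θ hA hG V σ.2.1
    have hle : f ((CFC.sqrt σ.1).transpose, R) ≤ f (θ, Q) :=
      hmax ⟨(hsq_transpose_sqrt σ.2).le, fun x _ => hR x⟩
    -- The root fidelities for `σ` average to at most `c`, so some message has error at least `1 -
    -- c²`.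
    obtain ⟨x, -, hx⟩ : ∃ x ∈ (Finset.univ : Finset (Fin k)),
        ((CFC.sqrt σ.1).transpose * (R x * keyVec A G V x)).trace.re ≤ c := by
      refine Finset.exists_le_of_sum_le Finset.univ_nonempty ?_
      rw [Finset.sum_const, Finset.card_univ, Fintype.card_fin, nsmul_eq_mul, hc,
        mul_div_cancel₀ _ hk0.ne']
      exact hle
    refine le_trans ?_ (le_ciSup (Set.finite_range _).bddAbove x)
    rw [hF]
    exact sub_le_sub_left (pow_le_pow_left₀ (h0 x) hx 2) 1
  refine ⟨Q, hQ, ?_⟩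
  have hcT : c = (θ * (testMatrix Q G * krausApply (sliceSnd V) (refVec A))).trace.re := by
    rw [testMatrix_mul_refVec, Matrix.mul_smul, Matrix.trace_smul, Matrix.mul_sum,
      Matrix.trace_sum, hc, smul_eq_mul, ← Complex.ofReal_natCast, ← Complex.ofReal_inv,
      Complex.re_ofReal_mul, Complex.re_sum, div_eq_inv_mul]
  -- Cauchy–Schwarz discards `θ`: the pass probability is at least `c² ≥ 1 - ε`.
  have h1 := norm_trace_mul_sq_le θ (testMatrix Q G * krausApply (sliceSnd V) (refVec A))
  have h2 : c ^ 2 ≤ ‖(θ * (testMatrix Q G * krausApply (sliceSnd V) (refVec A))).trace‖ ^ 2 := by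
    rw [hcT, ← sq_abs]
    exact pow_le_pow_left₀ (abs_nonneg _) (Complex.abs_re_le_norm _) 2
  have h3 : 0 ≤ hsq (testMatrix Q G * krausApply (sliceSnd V) (refVec A)) := nsq_nonneg _
  nlinarith

/-- A protocol of private communication of `k` messages bounds `J^ε_min`. -/
lemma Jmin_le_of_privateError_le [DecidableEq a] [Nonempty a] [DecidableEq b] {ε : ℝ} (hε₀ : 0 ≤ ε)
    {N : Matrix a a ℂ →ₗ[ℂ] Matrix b b ℂ} (hN : IsChannel N) {V : Matrix (b × e) a ℂ}
    (hV : IsIsometricExtension N V) (hk : 1 ≤ k) (Θ : OneWayLOCC a b (Fin k) (Fin k))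
    (hε : privateError Θ V ≤ ε) :
    Jmin ε N ≤ ((k : ℝ)⁻¹ + √ε) ^ 2 ∧ Jmin ε N ≤ ((k : ℝ)⁻¹) ^ 2 + √ε := by
  have : NeZero k := ⟨by omega⟩
  have hk0 : (0 : ℝ) < (k : ℝ)⁻¹ := inv_pos.2 (by exact_mod_cast hk)
  choose A hA using fun m => (Θ.pre_cp m).exists_kraus
  choose G hG using fun m => (Θ.post_channel m).1.exists_kraus
  have hGiso : ∀ m v, ∑ s, nsq ((G m s).mulVec v) = nsq v := fun m v =>
    (Θ.post_channel m).2.sum_nsq_kraus (hG m) v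
  have hAnorm : ∀ x, ∑ m, ∑ j, nsq (fun i => A m j i x) = 1 := by
    intro x
    have h1 := Θ.pre_tp.sum_nsq_kraus (G := fun p : Fin Θ.labels × (Fin k × a) => A p.1 p.2)
      (fun X => by
        rw [LinearMap.sum_apply, Fintype.sum_prod_type]
        exact Finset.sum_congr rfl fun m _ => hA m X) (Pi.single x 1)
    rw [Fintype.sum_prod_type] at h1
    simp only [Matrix.mulVec_single_one] at h1
    refine Eq.trans h1 ?_
    simp [nsq, Pi.single_apply, apply_ite (fun z : ℂ => ‖z‖)]
  have hlab : Nonempty (Fin Θ.labels) := by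
    by_contra hne
    rw [not_nonempty_iff] at hne
    simpa using hAnorm 0
  have he : Nonempty e := by
    by_contra hne
    rw [not_nonempty_iff] at hne
    obtain ⟨i⟩ := ‹Nonempty a›
    have := congrFun (congrFun hV.1 i) i
    simp [Matrix.mul_apply] at this
  obtain ⟨Q, hQ, hT⟩ := exists_test_of_privateError_le hk Θ hA hG V hε
  have hNV : ∀ X, N X = ∑ f, sliceSnd V f * X * (sliceSnd V f).conjTranspose := fun X => by
    rw [← hV.2, traceSnd_conj]
  have hρ := isState_refVec hAnorm
  -- The quantified `t` lets one argument serve both bounds.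
  have main : ∀ M ∈ freeChannels N, ∀ t : ℝ,
      (∀ x : ℝ, x ≤ ((k : ℝ)⁻¹ + √ε) ^ 2 ∧ x ≤ ((k : ℝ)⁻¹) ^ 2 + √ε → x ≤ t) →
      ∃ (n : ℕ) (ρ : Matrix (Fin n × a) (Fin n × a) ℂ), IsState ρ ∧
        hypTestError ε (idTensor (Fin n) N ρ) (idTensor (Fin n) M ρ) ≤ t := by
    rintro M ⟨P, hP, hPN, hPM⟩ t hbound
    obtain ⟨C, hC⟩ := hP.1.exists_kraus
    have hN' : ∀ X, N X = ∑ p : b × (a × (b × b)),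
        sliceSnd (C p.2) p.1 * X * (sliceSnd (C p.2) p.1).conjTranspose := fun X => by
      rw [← hPN, hC, traceSnd_kraus]
    have hM' : ∀ X, M X = ∑ p : b × (a × (b × b)),
        sliceFst (C p.2) p.1 * X * (sliceFst (C p.2) p.1).conjTranspose := fun X => by
      rw [← hPM, hC, traceFst_kraus]
    set Ψ := refVec A
    set Ω := krausApply (fun p : b × (a × (b × b)) => sliceSnd (C p.2) p.1) Ψ with hΩdef
    set Ω' := krausApply (fun p : b × (a × (b × b)) => sliceFst (C p.2) p.1) Ψ with hΩ'def
    set T := testMatrix Q G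
    let R := Fin k × (Fin Θ.labels × (Fin k × a))
    have hNΩ : idTensor R N (Ψ * Ψ.conjTranspose) = Ω * Ω.conjTranspose :=
      idTensor_mul_conjTranspose hN' Ψ
    have hMΩ : idTensor R M (Ψ * Ψ.conjTranspose) = Ω' * Ω'.conjTranspose :=
      idTensor_mul_conjTranspose hM' Ψ
    have hΩ1 : hsq Ω = 1 := by
      have : ((hsq Ω : ℝ) : ℂ) = 1 := by
        rw [← trace_mul_conjTranspose, ← hNΩ, trace_idTensor hN.2, hρ.2]
      exact_mod_cast this
    have hTΩ : 1 - ε ≤ hsq (T * Ω) := by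
      -- The pass probability depends only on the output of `N`, so the purification through `V` may
      -- be exchanged for the one through `P`.
      rw [← trace_test, ← hNΩ, idTensor_mul_conjTranspose hNV Ψ, trace_test]
      exact hT
    have hlabel : ∀ x μ j β f m, μ ≠ m → Ω ((x, (μ, j)), β) (f, m) = 0 := by
      intro x μ j β f m hne
      simp [hΩdef, krausApply, Ψ, refVec, hne]
    have hle := hsq_testMatrix_mul_swap_le hQ hGiso (Ω' := Ω') hΩ1 hlabel
      (fun _ _ _ _ _ => rfl) hε₀ hTΩ
    rw [Fintype.card_fin] at hle
    let g : Fin (Fintype.card R) ≃ R := (Fintype.equivFin R).symm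
    refine ⟨Fintype.card R, (Ψ * Ψ.conjTranspose).submatrix (g.prodCongr (Equiv.refl a))
      (g.prodCongr (Equiv.refl a)), ⟨hρ.1.submatrix _, ?_⟩, ?_⟩
    · rw [← hρ.2]
      exact Fintype.sum_equiv (g.prodCongr (Equiv.refl a)) _ _ fun _ => rfl
    · have hsub : ∀ Φ : Matrix a a ℂ →ₗ[ℂ] Matrix b b ℂ,
          idTensor (Fin (Fintype.card R)) Φ ((Ψ * Ψ.conjTranspose).submatrix
            (g.prodCongr (Equiv.refl a)) (g.prodCongr (Equiv.refl a)))
          = (idTensor R Φ (Ψ * Ψ.conjTranspose)).submatrix (g.prodCongr (Equiv.refl b))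
            (g.prodCongr (Equiv.refl b)) := fun _ => rfl
      rw [hsub, hsub]
      refine hypTestError_submatrix_le (Λ := T.conjTranspose * T) _
        (hMΩ ▸ Matrix.posSemidef_self_mul_conjTranspose Ω')
        (Matrix.posSemidef_conjTranspose_mul_self T) (contr_testMatrix hQ hGiso).posSemidef_one_sub
        ?_ ?_
      · rw [hNΩ, trace_test]; exact hTΩ
      · rw [hMΩ, trace_test]; exact hbound _ hle
  have hsε := Real.sqrt_nonneg ε
  exact ⟨Jmin_le (by positivity) fun M hM => main M hM _ fun _ h => h.1,
    Jmin_le (by positivity) fun M hM => main M hM _ fun _ h => h.2⟩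

end Main

end QKey

end

theorem corollary4 {a b e : Type*} [Fintype a] [DecidableEq a] [Nonempty a]
    [Fintype b] [DecidableEq b] [Nonempty b] [Fintype e] [DecidableEq e]
    (ε : ℝ) (hε₀ : 0 ≤ ε) (hε₁ : ε ≤ 1)
    (N : Matrix a a ℂ →ₗ[ℂ] Matrix b b ℂ) (hN : QKey.IsChannel N)
    (V : Matrix (b × e) a ℂ) (hV : QKey.IsIsometricExtension N V)
    (hJ : ε < QKey.Jmin ε N) :
    QKey.forwardPrivateCapacity ε V
        ≤ ((-Real.logb 2 (Real.sqrt (QKey.Jmin ε N) - Real.sqrt ε) : ℝ) : EReal) ∧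
      (Real.sqrt ε < QKey.Jmin ε N →
        QKey.forwardPrivateCapacity ε V
          ≤ ((-(1 / 2) * Real.logb 2 (QKey.Jmin ε N - Real.sqrt ε) : ℝ) : EReal)) := by
  constructor
  · refine iSup_le fun k => iSup_le fun hk => iSup_le fun Θ => iSup_le fun _ => iSup_le fun hΘ => ?_
    have h := (QKey.Jmin_le_of_privateError_le hε₀ hN hV hk Θ hΘ).1
    have hk0 : (0 : ℝ) < (k : ℝ)⁻¹ := inv_pos.2 (by exact_mod_cast hk)
    have h1 : √(QKey.Jmin ε N) ≤ (k : ℝ)⁻¹ + √ε := Real.sqrt_le_iff.2 ⟨by positivity, h⟩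
    -- Keeps the argument of the logarithm positive, as its monotonicity requires.
    have h2 : √ε < √(QKey.Jmin ε N) := Real.sqrt_lt_sqrt hε₀ hJ
    rw [EReal.coe_le_coe_iff, le_neg, ← Real.logb_inv]
    exact Real.logb_le_logb_of_le one_lt_two (by linarith) (by linarith)
  · intro hJ'
    refine iSup_le fun k => iSup_le fun hk => iSup_le fun Θ => iSup_le fun _ => iSup_le fun hΘ => ?_
    have h := (QKey.Jmin_le_of_privateError_le hε₀ hN hV hk Θ hΘ).2
    have h1 := Real.logb_le_logb_of_le one_lt_two (sub_pos.2 hJ') (sub_le_iff_le_add.2 h)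
    rw [inv_pow, Real.logb_inv, Real.logb_pow] at h1
    rw [EReal.coe_le_coe_iff]
    push_cast at h1
    linarith
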